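/- Let $M$ be a smooth manifold of dimension $6$ with a Riemannian metric $g$ and an $SU(3)$-structure compatible with $g$: a smooth almost complex structure $J$ with $g(JX,JY)=g(X,Y)$, and a smooth complex $3$-form $\Psi=\Psi^++\sqrt{-1}\,\Psi^-$ that at each point can be written $\Psi=-(e_1+\sqrt{-1}\,e_2)\wedge(e_3+\sqrt{-1}\,e_4)\wedge(e_5+\sqrt{-1}\,e_6)$ for some orthonormal basis $e_1,\dots,e_6$ (identified with its dual basis) with $Je_1=e_2$, $Je_3=e_4$, $Je_5=e_6$. Suppose that $(M,g,J,\Psi)$ is an almost Calabi-Yau manifold with torsion (ACYT), i.e. that there is a linear connection $\nabla$ (the torsion connection) with $\nabla g=\nabla J=\nabla\Psi^+=\nabla\Psi^-=0$ whose torsion $T(X,Y,Z)=g(\nabla_XY-\nabla_YX-[X,Y],Z)$ is totally skew-symmetric. Let $\delta$ be the codifferential of $g$, $\delta\omega=-\sum_i e_i\lrcorner\nabla^g_{e_i}\omega$ with $\nabla^g$ the Levi-Civita connection and $(e_i)$ an orthonormal frame (in even dimension $\delta=-*d*$). Suppose that the manifold is balanced, i.e. that the Lee form $\theta(X)=(\delta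 F)(JX)$ of the Kähler form $F(X,Y)=g(X,JY)$ vanishes, $\theta=0$. Then the following conditions are equivalent: a) the Ricci tensor of the torsion connection vanishes, $Ric=0$, where $Ric(X,Y)=\sum_i g(R(e_i,X)Y,e_i)$ and $R(X,Y)=[\nabla_X,\nabla_Y]-\nabla_{[X,Y]}$; b) the torsion $3$-form is harmonic, i.e. closed and co-closed, $dT=\delta T=0$. -/

import Mathlib

open Bundle FiberBundle VectorField
open scoped Manifold ContDiff Topology

set_option linter.unusedSectionVars false

noncomputable section

namespace TorsionGeometry

/-! Throughout, `M` is a manifold whose tangent bundle carries a Riemannian metric `g`, written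
`inner ℝ`. Mathlib writes `∇ Y x v` for the covariant derivative `(∇_v Y)(x)`, and `extend E v` for a
vector field, smooth near `x`, whose value at `x` is the tangent vector `v`. -/

section Instances

variable {E : Type*} [NormedAddCommGroup E] [NormedSpace ℝ E] [FiniteDimensional ℝ E]
  {H : Type*} [TopologicalSpace H] {I : ModelWithCorners ℝ E H}
  {M : Type*} [TopologicalSpace M] [ChartedSpace H M]

instance instFiniteDimensionalTangentSpace (x : M) : FiniteDimensional ℝ (TangentSpace I x) :=
  inferInstanceAs (FiniteDimensional ℝ E)

instance instCompleteSpaceTangentSpace [RiemannianBundle (fun x : M ↦ TangentSpace I x)] (x : M) :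
    CompleteSpace (TangentSpace I x) :=
  FiniteDimensional.complete ℝ _

end Instances

/-! ### The Levi-Civita connection, built from the Koszul formula -/

section LeviCivita

variable {E : Type*} [NormedAddCommGroup E] [NormedSpace ℝ E]
  {H : Type*} [TopologicalSpace H] (I : ModelWithCorners ℝ E H)
  {M : Type*} [TopologicalSpace M] [ChartedSpace H M] [IsManifold I 2 M]
  [RiemannianBundle (fun x : M ↦ TangentSpace I x)]

/-- The right-hand side of the Koszul formula for `2 g(∇_X Y, Z)`, at the point `x`. -/
def koszul (Y X Z : Π x : M, TangentSpace I x) (x : M) : ℝ :=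
  mvfderiv I (fun y ↦ inner ℝ (Y y) (Z y)) x (X x)
    + mvfderiv I (fun y ↦ inner ℝ (X y) (Z y)) x (Y x)
    - mvfderiv I (fun y ↦ inner ℝ (X y) (Y y)) x (Z x)
    + inner ℝ (mlieBracket I X Y x) (Z x)
    - inner ℝ (mlieBracket I X Z x) (Y x)
    - inner ℝ (mlieBracket I Y Z x) (X x)

variable [FiniteDimensional ℝ E] [IsContMDiffRiemannianBundle I 1 E (fun x : M ↦ TangentSpace I x)]
variable {I}

theorem mdifferentiableAt_inner {x : M} {Y Z : Π x : M, TangentSpace I x}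
    (hY : MDiffAt (T% Y) x) (hZ : MDiffAt (T% Z) x) : MDiffAt (fun y ↦ inner ℝ (Y y) (Z y)) x :=
  MDifferentiableAt.inner_bundle (E := fun x : M ↦ TangentSpace I x) (b := id) hY hZ

theorem koszul_tensorial_left {x : M} {Y Z : Π x : M, TangentSpace I x}
    (hY : MDiffAt (T% Y) x) (hZ : MDiffAt (T% Z) x) :
    TensorialAt I E (fun X ↦ koszul I Y X Z x) x where
  smul {f X} hf hX := by
    simp [koszul, mvfderiv_fun_mul hf (mdifferentiableAt_inner hX hZ),
      mvfderiv_fun_mul hf (mdifferentiableAt_inner hX hY), inner_smul_left, inner_smul_right,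
      inner_add_left, mlieBracket_smul_left hf hX]
    ring
  add {X X'} hX hX' := by
    simp [koszul, mvfderiv_fun_add (mdifferentiableAt_inner hX hZ) (mdifferentiableAt_inner hX' hZ),
      mvfderiv_fun_add (mdifferentiableAt_inner hX hY) (mdifferentiableAt_inner hX' hY),
      inner_add_left, inner_add_right, mlieBracket_add_left hX hX']
    ring

theorem koszul_tensorial_right {x : M} {Y X : Π x : M, TangentSpace I x}
    (hY : MDiffAt (T% Y) x) (hX : MDiffAt (T% X) x) :
    TensorialAt I E (fun Z ↦ koszul I Y X Z x) x where
  smul {f Z} hf hZ := by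
    simp [koszul, mvfderiv_fun_mul hf (mdifferentiableAt_inner hY hZ),
      mvfderiv_fun_mul hf (mdifferentiableAt_inner hX hZ), inner_smul_left, inner_smul_right,
      inner_add_left, mlieBracket_smul_right hf hZ]
    rw [real_inner_comm (Z x) (X x), real_inner_comm (Z x) (Y x)]
    ring
  add {Z Z'} hZ hZ' := by
    simp [koszul, mvfderiv_fun_add (mdifferentiableAt_inner hY hZ) (mdifferentiableAt_inner hY hZ'),
      mvfderiv_fun_add (mdifferentiableAt_inner hX hZ) (mdifferentiableAt_inner hX hZ'),
      inner_add_left, inner_add_right, mlieBracket_add_right hZ hZ']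
    ring

variable (I) in
/-- For a vector field `Y` differentiable at `x`, the bilinear form `(X, Z) ↦ g(∇_X Y, Z)` on the
tangent space at `x`. -/
def koszulForm (Y : Π x : M, TangentSpace I x) (x : M) (hY : MDiffAt (T% Y) x) :
    TangentSpace I x →L[ℝ] TangentSpace I x →L[ℝ] ℝ :=
  (2⁻¹ : ℝ) • TensorialAt.mkHom₂ (fun X Z ↦ koszul I Y X Z x) x
    (fun _ hZ ↦ koszul_tensorial_left hY hZ) (fun _ hX ↦ koszul_tensorial_right hY hX)

theorem koszulForm_apply {Y X Z : Π x : M, TangentSpace I x} {x : M} (hY : MDiffAt (T% Y) x)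
    (hX : MDiffAt (T% X) x) (hZ : MDiffAt (T% Z) x) :
    koszulForm I Y x hY (X x) (Z x) = 2⁻¹ * koszul I Y X Z x := by
  simp only [koszulForm, _root_.smul_apply, smul_eq_mul]
  rw [TensorialAt.mkHom₂_apply _ _ hX hZ]

variable (I) in
/-- The linear form `α` on the tangent space, seen as a vector through the metric. -/
def sharp (x : M) : (TangentSpace I x →L[ℝ] ℝ) →L[ℝ] TangentSpace I x :=
  haveI : FiniteDimensional ℝ (TangentSpace I x →L[ℝ] ℝ) := Module.Finite.equiv
    (LinearMap.toContinuousLinearMap : (TangentSpace I x →ₗ[ℝ] ℝ) ≃ₗ[ℝ] TangentSpace I x →L[ℝ] ℝ)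
  LinearMap.toContinuousLinearMap
    { toFun := (InnerProductSpace.toDual ℝ (TangentSpace I x)).symm
      map_add' := fun α β ↦ map_add _ α β
      map_smul' := fun c α ↦ by simp }

theorem inner_sharp (x : M) (α : TangentSpace I x →L[ℝ] ℝ) (v : TangentSpace I x) :
    inner ℝ (sharp I x α) v = α v :=
  InnerProductSpace.toDual_symm_apply (𝕜 := ℝ) (E := TangentSpace I x)

variable (I) in
open Classical in
/-- The vector `∇_X Y` of the Levi-Civita connection, for `Y` differentiable at `x` (and `0` at
points where `Y` is not differentiable). -/
def leviCivitaFun (Y : Π x : M, TangentSpace I x) (x : M) : TangentSpace I x →L[ℝ] TangentSpace I x :=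
  if hY : MDiffAt (T% Y) x then sharp I x ∘L koszulForm I Y x hY else 0

theorem inner_leviCivitaFun {Y X Z : Π x : M, TangentSpace I x} {x : M} (hY : MDiffAt (T% Y) x)
    (hX : MDiffAt (T% X) x) (hZ : MDiffAt (T% Z) x) :
    inner ℝ (leviCivitaFun I Y x (X x)) (Z x) = 2⁻¹ * koszul I Y X Z x := by
  rw [leviCivitaFun, dif_pos hY, ContinuousLinearMap.comp_apply, inner_sharp,
    koszulForm_apply hY hX hZ]

theorem ext_inner_fields {x : M} {A B : TangentSpace I x →L[ℝ] TangentSpace I x}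
    (h : ∀ X Z : Π x : M, TangentSpace I x, MDiffAt (T% X) x → MDiffAt (T% Z) x →
      (inner ℝ (A (X x)) (Z x) : ℝ) = inner ℝ (B (X x)) (Z x)) : A = B := by
  ext1 v
  refine ext_inner_right ℝ fun w ↦ ?_
  simpa using h (extend E v) (extend E w) (mdifferentiableAt_extend ..)
    (mdifferentiableAt_extend ..)

variable (I M) in
/-- The Levi-Civita connection of the Riemannian metric. -/
def leviCivita : CovariantDerivative I E (TangentSpace I : M → Type _) where
  toFun := leviCivitaFun I
  isCovariantDerivativeOnUniv :=
    { add := fun {Y Y' x} hY hY' _ ↦ by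
        refine ext_inner_fields fun X Z hX hZ ↦ ?_
        rw [inner_leviCivitaFun (mdifferentiableAt_add_section hY hY') hX hZ, add_apply,
          inner_add_left, inner_leviCivitaFun hY hX hZ, inner_leviCivitaFun hY' hX hZ]
        simp [koszul, mvfderiv_fun_add (mdifferentiableAt_inner hY hZ)
          (mdifferentiableAt_inner hY' hZ),
          mvfderiv_fun_add (mdifferentiableAt_inner hX hY) (mdifferentiableAt_inner hX hY'),
          inner_add_left, inner_add_right, mlieBracket_add_right hY hY',
          mlieBracket_add_left hY hY']
        ring
      leibniz := fun {Y f x} hY hf _ ↦ by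
        refine ext_inner_fields fun X Z hX hZ ↦ ?_
        rw [inner_leviCivitaFun (hf.smul_section hY) hX hZ, add_apply,
          inner_add_left, _root_.smul_apply, inner_smul_left, inner_leviCivitaFun hY hX hZ]
        simp [koszul, mvfderiv_fun_mul hf (mdifferentiableAt_inner hY hZ),
          mvfderiv_fun_mul hf (mdifferentiableAt_inner hX hY),
          inner_add_left, inner_smul_left, inner_smul_right, mlieBracket_smul_right hf hY,
          mlieBracket_smul_left hf hY]
        rw [real_inner_comm (X x) (Y x)]
        ring }

theorem inner_leviCivita {Y X Z : Π x : M, TangentSpace I x} {x : M} (hY : MDiffAt (T% Y) x)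
    (hX : MDiffAt (T% X) x) (hZ : MDiffAt (T% Z) x) :
    inner ℝ (leviCivita I M Y x (X x)) (Z x) = 2⁻¹ * koszul I Y X Z x :=
  inner_leviCivitaFun hY hX hZ

theorem leviCivita_torsion : (leviCivita I M).torsion = 0 := by
  rw [CovariantDerivative.torsion_eq_zero_iff]
  intro X Y x hX hY
  refine ext_inner_right ℝ fun w ↦ ?_
  have hw : extend E w x = w := by simp
  have hZ : MDiffAt (T% (extend E w)) x := mdifferentiableAt_extend ..
  rw [← hw, inner_sub_left, inner_leviCivita hY hX hZ, inner_leviCivita hX hY hZ]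
  have h1 : (fun y ↦ (inner ℝ (X y) (Y y) : ℝ)) = fun y ↦ inner ℝ (Y y) (X y) :=
    funext fun y ↦ real_inner_comm _ _
  rw [koszul, koszul, h1, mlieBracket_swap_apply (V := Y) (W := X), inner_neg_left]
  ring

theorem leviCivita_metric :
    CovariantDerivative.IsMetricCompatible (V := fun x : M ↦ TangentSpace I x)
      (leviCivita I M) := by
  rw [CovariantDerivative.isMetricCompatible_iff (V := fun x : M ↦ TangentSpace I x)]
  intro x X Y Z hX hY hZ
  change _ = (inner ℝ (leviCivita I M Y x (X x)) (Z x) : ℝ)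
    + inner ℝ (Y x) (leviCivita I M Z x (X x))
  rw [real_inner_comm _ (Y x), inner_leviCivita hY hX hZ, inner_leviCivita hZ hX hY]
  have h1 : (fun y ↦ (inner ℝ (Z y) (Y y) : ℝ)) = fun y ↦ inner ℝ (Y y) (Z y) :=
    funext fun y ↦ real_inner_comm _ _
  rw [koszul, koszul, h1, mlieBracket_swap_apply (V := Z) (W := Y), inner_neg_left]
  ring

end LeviCivita

/-! ### Differential forms: exterior derivative, covariant derivative, codifferential -/

section Forms

variable {E : Type*} [NormedAddCommGroup E] [NormedSpace ℝ E]
  {M : Type*} [TopologicalSpace M] [ChartedSpace E M] [IsManifold 𝓘(ℝ, E) ∞ M]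
  {W : Type*} [NormedAddCommGroup W] [NormedSpace ℝ W] {p : ℕ}

/-- A `p`-form is smooth if its values on smooth vector fields are smooth. -/
def IsSmoothForm (η : Π x : M, TangentSpace 𝓘(ℝ, E) x [⋀^Fin p]→L[ℝ] W) : Prop :=
  ∀ (x : M) (X : Fin p → Π y : M, TangentSpace 𝓘(ℝ, E) y), (∀ i, CMDiffAt ∞ (T% (X i)) x) →
    ContMDiffAt 𝓘(ℝ, E) 𝓘(ℝ, W) ∞ (fun y ↦ η y (fun i ↦ X i y)) x

/-- The exterior derivative of a form on `M`, computed in the preferred chart at each point: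
the form is pulled back to the model space by the inverse of the chart, differentiated there, and
the result is pulled back to `M` by the chart. -/
def extDerivForm (η : Π x : M, TangentSpace 𝓘(ℝ, E) x [⋀^Fin p]→L[ℝ] W) (x : M) :
    TangentSpace 𝓘(ℝ, E) x [⋀^Fin (p + 1)]→L[ℝ] W :=
  (extDeriv (E := E) (fun z ↦ (η ((extChartAt 𝓘(ℝ, E) x).symm z)).compContinuousLinearMap
      (mfderiv 𝓘(ℝ, E) 𝓘(ℝ, E) (extChartAt 𝓘(ℝ, E) x).symm z))
    (extChartAt 𝓘(ℝ, E) x x)).compContinuousLinearMap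
      (mfderiv 𝓘(ℝ, E) 𝓘(ℝ, E) (extChartAt 𝓘(ℝ, E) x) x)

/-- The value at `x` of `(∇_u η)(v 0, …, v (p - 1))`, given by the Leibniz rule. -/
def covDerivForm (D : CovariantDerivative 𝓘(ℝ, E) E (TangentSpace 𝓘(ℝ, E) : M → Type _))
    (η : Π x : M, TangentSpace 𝓘(ℝ, E) x [⋀^Fin p]→L[ℝ] W) (x : M) (u : TangentSpace 𝓘(ℝ, E) x)
    (v : Fin p → TangentSpace 𝓘(ℝ, E) x) : W :=
  mvfderiv 𝓘(ℝ, E) (fun y ↦ η y (fun i ↦ extend E (v i) y)) x u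
    - ∑ i, η x (Function.update v i (D (extend E (v i)) x u))

/-- The value at `x` of `(∇_u A) v = ∇_u (A v) - A (∇_u v)`, for a field `A` of endomorphisms. -/
def covDerivEnd (D : CovariantDerivative 𝓘(ℝ, E) E (TangentSpace 𝓘(ℝ, E) : M → Type _))
    (A : Π x : M, TangentSpace 𝓘(ℝ, E) x →L[ℝ] TangentSpace 𝓘(ℝ, E) x) (x : M)
    (u v : TangentSpace 𝓘(ℝ, E) x) : TangentSpace 𝓘(ℝ, E) x :=
  D (fun y ↦ A y (extend E v y)) x u - A x (D (extend E v) x u)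

/-- The value at `x` of `R(u, v) w = ∇_u ∇_v w - ∇_v ∇_u w - ∇_[u, v] w`. -/
def curvature (D : CovariantDerivative 𝓘(ℝ, E) E (TangentSpace 𝓘(ℝ, E) : M → Type _)) (x : M)
    (u v w : TangentSpace 𝓘(ℝ, E) x) : TangentSpace 𝓘(ℝ, E) x :=
  D (fun y ↦ D (extend E w) y (extend E v y)) x u
    - D (fun y ↦ D (extend E w) y (extend E u y)) x v
    - D (extend E w) x (mlieBracket 𝓘(ℝ, E) (extend E u) (extend E v) x)

variable [FiniteDimensional ℝ E] [RiemannianBundle (fun x : M ↦ TangentSpace 𝓘(ℝ, E) x)]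

/-- The Ricci tensor `Ric(v, w) = ∑ i, g(R(e i, v) w, e i)`, with `e` an orthonormal basis. -/
def ricci (D : CovariantDerivative 𝓘(ℝ, E) E (TangentSpace 𝓘(ℝ, E) : M → Type _)) (x : M)
    (v w : TangentSpace 𝓘(ℝ, E) x) : ℝ :=
  ∑ i, inner ℝ (curvature D x (stdOrthonormalBasis ℝ (TangentSpace 𝓘(ℝ, E) x) i) v w)
    (stdOrthonormalBasis ℝ (TangentSpace 𝓘(ℝ, E) x) i)

variable [IsContMDiffRiemannianBundle 𝓘(ℝ, E) ∞ E (fun x : M ↦ TangentSpace 𝓘(ℝ, E) x)]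

/-- The codifferential `δη = - ∑ i, e i ⌟ ∇^g_{e i} η` of a `(p + 1)`-form, where `∇^g` is the
Levi-Civita connection and `e` is an orthonormal basis. -/
def codifferential (η : Π x : M, TangentSpace 𝓘(ℝ, E) x [⋀^Fin (p + 1)]→L[ℝ] ℝ) (x : M)
    (v : Fin p → TangentSpace 𝓘(ℝ, E) x) : ℝ :=
  -∑ i, covDerivForm (leviCivita 𝓘(ℝ, E) M) η x (stdOrthonormalBasis ℝ (TangentSpace 𝓘(ℝ, E) x) i)
    (Fin.cons (stdOrthonormalBasis ℝ (TangentSpace 𝓘(ℝ, E) x) i) v)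

/-- The torsion is totally skew-symmetric: `g(T(u, v), w) = - g(T(u, w), v)`. -/
def HasSkewTorsion
    (D : CovariantDerivative 𝓘(ℝ, E) E (TangentSpace 𝓘(ℝ, E) : M → Type _)) : Prop :=
  ∀ (x : M) (u v w : TangentSpace 𝓘(ℝ, E) x),
    (inner ℝ (D.torsion x u v) w : ℝ) = -inner ℝ (D.torsion x u w) v

/-- The torsion `3`-form `T(u, v, w) = g(T(u, v), w)`. -/
def torsionForm (D : CovariantDerivative 𝓘(ℝ, E) E (TangentSpace 𝓘(ℝ, E) : M → Type _))
    (hD : HasSkewTorsion D) (x : M) : TangentSpace 𝓘(ℝ, E) x [⋀^Fin 3]→L[ℝ] ℝ where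
  toFun v := inner ℝ (D.torsion x (v 0) (v 1)) (v 2)
  map_update_add' {inst} v i a b := by
    obtain rfl : inst = instDecidableEqFin _ := Subsingleton.elim _ _
    fin_cases i <;> simp [inner_add_left, inner_add_right]
  map_update_smul' {inst} v i c a := by
    obtain rfl : inst = instDecidableEqFin _ := Subsingleton.elim _ _
    fin_cases i <;> simp [inner_smul_left, inner_smul_right]
  cont := by
    fun_prop
  map_eq_zero_of_eq' v i j h hij := by
    have h01 : ∀ u w, (inner ℝ (D.torsion x u u) w : ℝ) = 0 := fun u w ↦ by simp
    have h12 : ∀ u w, (inner ℝ (D.torsion x w u) u : ℝ) = 0 := fun u w ↦ by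
      have := hD x w u u
      linarith
    have h02 : ∀ u w, (inner ℝ (D.torsion x u w) u : ℝ) = 0 := fun u w ↦ by
      rw [hD, h01, neg_zero]
    fin_cases i <;> fin_cases j <;> simp_all

end Forms

/-! ### Almost Hermitian structures, SU(3)-structures, and their torsion connections -/

section Structures

variable (E : Type*) [NormedAddCommGroup E] [NormedSpace ℝ E] [FiniteDimensional ℝ E]
  (M : Type*) [TopologicalSpace M] [ChartedSpace E M] [IsManifold 𝓘(ℝ, E) ∞ M]
  [RiemannianBundle (fun x : M ↦ TangentSpace 𝓘(ℝ, E) x)]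

/-- A smooth almost complex structure `J` that is orthogonal for the Riemannian metric. -/
structure AlmostHermitian where
  /-- The almost complex structure. -/
  J : Π x : M, TangentSpace 𝓘(ℝ, E) x →L[ℝ] TangentSpace 𝓘(ℝ, E) x
  smooth_J : ContMDiff 𝓘(ℝ, E) (𝓘(ℝ, E).prod 𝓘(ℝ, E →L[ℝ] E)) ∞
    (fun x ↦ TotalSpace.mk' (E →L[ℝ] E)
      (E := fun x : M ↦ TangentSpace 𝓘(ℝ, E) x →L[ℝ] TangentSpace 𝓘(ℝ, E) x) x (J x))
  J_sq : ∀ (x : M) (v : TangentSpace 𝓘(ℝ, E) x), J x (J x v) = -v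
  inner_J : ∀ (x : M) (v w : TangentSpace 𝓘(ℝ, E) x),
    (inner ℝ (J x v) (J x w) : ℝ) = inner ℝ v w

/-- An SU(3)-structure: an almost Hermitian structure with a smooth complex `3`-form
`Ψ = Ψ⁺ + i Ψ⁻` such that around each point there are orthonormal covectors `e₁, …, e₆`, with
`J e₁ = e₂`, `J e₃ = e₄`, `J e₅ = e₆` for the dual basis, in which
`Ψ = -(e₁ + i e₂) ∧ (e₃ + i e₄) ∧ (e₅ + i e₆)`. The basis is indexed here by pairs: `e (a, 0)` and
`e (a, 1)` stand for `e_{2a+1}` and `e_{2a+2}`. -/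
structure SU3Structure extends AlmostHermitian E M where
  /-- The complex volume form. -/
  Ψ : Π x : M, TangentSpace 𝓘(ℝ, E) x [⋀^Fin 3]→L[ℝ] ℂ
  smooth_Ψ : IsSmoothForm Ψ
  exists_adapted_basis : ∀ x : M,
    ∃ e : OrthonormalBasis (Fin 3 × Fin 2) ℝ (TangentSpace 𝓘(ℝ, E) x),
      (∀ a, J x (e (a, 0)) = e (a, 1)) ∧
      ∀ v : Fin 3 → TangentSpace 𝓘(ℝ, E) x,
        Ψ x v = -Matrix.det (Matrix.of fun a b : Fin 3 ↦
          ((inner ℝ (e (a, 0)) (v b) : ℝ) : ℂ) + Complex.I * ((inner ℝ (e (a, 1)) (v b) : ℝ) : ℂ))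

variable {E M}

/-- The Kähler form `F(u, v) = g(u, J v)`. -/
def AlmostHermitian.kahlerForm (S : AlmostHermitian E M) (x : M) :
    TangentSpace 𝓘(ℝ, E) x [⋀^Fin 2]→L[ℝ] ℝ where
  toFun v := inner ℝ (v 0) (S.J x (v 1))
  map_update_add' {inst} v i a b := by
    obtain rfl : inst = instDecidableEqFin _ := Subsingleton.elim _ _
    fin_cases i <;> simp [inner_add_left, inner_add_right]
  map_update_smul' {inst} v i c a := by
    obtain rfl : inst = instDecidableEqFin _ := Subsingleton.elim _ _
    fin_cases i <;> simp [inner_smul_left, inner_smul_right]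
  cont := by
    fun_prop
  map_eq_zero_of_eq' v i j h hij := by
    have key : ∀ u, (inner ℝ u (S.J x u) : ℝ) = 0 := fun u ↦ by
      have h1 := S.inner_J x u (S.J x u)
      rw [S.J_sq, inner_neg_right, real_inner_comm] at h1
      linarith
    fin_cases i <;> fin_cases j <;> simp_all

variable [IsContMDiffRiemannianBundle 𝓘(ℝ, E) ∞ E (fun x : M ↦ TangentSpace 𝓘(ℝ, E) x)]

/-- The Lee form `θ(v) = (δF)(J v)`. -/
def AlmostHermitian.leeForm (S : AlmostHermitian E M) (x : M) (v : TangentSpace 𝓘(ℝ, E) x) : ℝ :=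
  codifferential S.kahlerForm x ![S.J x v]

/-- The structure is balanced if its Lee form vanishes. -/
def AlmostHermitian.IsBalanced (S : AlmostHermitian E M) : Prop :=
  ∀ (x : M) (v : TangentSpace 𝓘(ℝ, E) x), S.leeForm x v = 0

/-- `D` is a smooth linear connection with totally skew-symmetric torsion that preserves the
SU(3)-structure: `∇g = ∇J = ∇Ψ = 0`. A manifold with an SU(3)-structure that has such a connection is
an ACYT manifold, and `D` is its torsion connection. -/
structure SU3Structure.IsTorsionConnection (S : SU3Structure E M)
    (D : CovariantDerivative 𝓘(ℝ, E) E (TangentSpace 𝓘(ℝ, E) : M → Type _)) : Prop where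
  smooth : CovariantDerivative.ContMDiffCovariantDerivative D ∞
  metric : CovariantDerivative.IsMetricCompatible (V := fun x : M ↦ TangentSpace 𝓘(ℝ, E) x) D
  parallel_J : ∀ (x : M) (u v : TangentSpace 𝓘(ℝ, E) x), covDerivEnd D S.J x u v = 0
  parallel_Ψ : ∀ (x : M) (u : TangentSpace 𝓘(ℝ, E) x) (v : Fin 3 → TangentSpace 𝓘(ℝ, E) x),
    covDerivForm D S.Ψ x u v = 0
  skew : HasSkewTorsion D

end Structures

end TorsionGeometry

end

noncomputable section

namespace TorsionGeometry

/-! ### Coordinate vector fields -/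

section Coordinate

variable {E : Type*} [NormedAddCommGroup E] [NormedSpace ℝ E]
  {M : Type*} [TopologicalSpace M] [ChartedSpace E M] [IsManifold 𝓘(ℝ, E) ∞ M]
  {W : Type*} [NormedAddCommGroup W] [NormedSpace ℝ W] {x : M}

theorem mem_baseSet_of_mem_source {y : M} (hy : y ∈ (chartAt E x).source) :
    y ∈ (trivializationAt E (TangentSpace 𝓘(ℝ, E)) x).baseSet := by
  rwa [TangentBundle.trivializationAt_baseSet]

theorem trivializationAt_self_apply (v : TangentSpace 𝓘(ℝ, E) x) :
    (trivializationAt E (TangentSpace 𝓘(ℝ, E)) x ⟨x, v⟩).2 = v :=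
  (tangentBundleCore 𝓘(ℝ, E) M).coordChange_self (achart E x) x (mem_chart_source E x) v

/-- The extension involves no cut-off: it is constant in the trivialization at `x`, hence a
constant-coefficient coordinate field on the whole chart domain. -/
theorem extend_eq_symmL (v : TangentSpace 𝓘(ℝ, E) x) {y : M}
    (hy : y ∈ (chartAt E x).source) :
    extend E v y = (trivializationAt E (TangentSpace 𝓘(ℝ, E)) x).symmL ℝ y (v : E) :=
  (congrArg ((trivializationAt E (TangentSpace 𝓘(ℝ, E)) x).symm y)
    (trivializationAt_self_apply v)).trans
    (Trivialization.symmL_apply _ (mem_baseSet_of_mem_source hy) _).symm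

theorem extend_add_apply (v w : TangentSpace 𝓘(ℝ, E) x) {y : M}
    (hy : y ∈ (chartAt E x).source) :
    extend E (v + w) y = extend E v y + extend E w y := by
  simp only [extend_eq_symmL _ hy]
  exact map_add _ (v : E) (w : E)

theorem extend_smul_apply (c : ℝ) (v : TangentSpace 𝓘(ℝ, E) x) {y : M}
    (hy : y ∈ (chartAt E x).source) :
    extend E (c • v) y = c • extend E v y := by
  simp only [extend_eq_symmL _ hy]
  exact map_smul _ c (v : E)

theorem mfderiv_extChartAt_self (v : TangentSpace 𝓘(ℝ, E) x) :
    mfderiv 𝓘(ℝ, E) 𝓘(ℝ, E) (extChartAt 𝓘(ℝ, E) x) x v = v := by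
  rw [← TangentBundle.continuousLinearMapAt_trivializationAt (mem_chart_source E x),
    TangentBundle.continuousLinearMapAt_trivializationAt_eq_core (mem_chart_source E x)]
  exact (tangentBundleCore 𝓘(ℝ, E) M).coordChange_self (achart E x) x (mem_chart_source E x) v

theorem extend_eq_mfderiv_symm (v : TangentSpace 𝓘(ℝ, E) x) {y : M}
    (hy : y ∈ (chartAt E x).source) :
    extend E v y = mfderiv 𝓘(ℝ, E) 𝓘(ℝ, E) (extChartAt 𝓘(ℝ, E) x).symm
      (extChartAt 𝓘(ℝ, E) x y) v := by
  rw [extend_eq_symmL v hy, TangentBundle.symmL_trivializationAt hy,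
    ModelWithCorners.range_eq_univ, mfderivWithin_univ]
  rfl

theorem mvfderiv_congr {f g : M → W} {y : M} (h : f =ᶠ[𝓝 y] g) :
    mvfderiv 𝓘(ℝ, E) f y = mvfderiv 𝓘(ℝ, E) g y := by
  ext v
  exact congr($(h.mfderiv_eq (I := 𝓘(ℝ, E)) (I' := 𝓘(ℝ, W))) v)

/-- The derivative along a coordinate field is the directional derivative in the chart. -/
theorem mvfderiv_extend {f : M → W} (v : TangentSpace 𝓘(ℝ, E) x) {y : M}
    (hy : y ∈ (chartAt E x).source) (hf : MDiffAt f y) :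
    mvfderiv 𝓘(ℝ, E) f y (extend E v y) =
      fderiv ℝ (fun z ↦ f ((extChartAt 𝓘(ℝ, E) x).symm z)) (extChartAt 𝓘(ℝ, E) x y) (v : E) := by
  have hy' : y ∈ (extChartAt 𝓘(ℝ, E) x).source := by simpa using hy
  have hinv := (extChartAt 𝓘(ℝ, E) x).left_inv hy'
  have hφ : MDiffAt (extChartAt 𝓘(ℝ, E) x).symm (extChartAt 𝓘(ℝ, E) x y) := by
    have := (contMDiffOn_extChartAt_symm (I := 𝓘(ℝ, E)) (n := 1) x).contMDiffAt
      ((isOpen_extChartAt_target x).mem_nhds ((extChartAt 𝓘(ℝ, E) x).map_source hy'))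
    exact this.mdifferentiableAt one_ne_zero
  rw [extend_eq_mfderiv_symm v hy, ← mfderiv_eq_fderiv]
  have := mfderiv_comp_apply_of_eq (I := 𝓘(ℝ, E)) (I' := 𝓘(ℝ, E)) (I'' := 𝓘(ℝ, W))
    (x := extChartAt 𝓘(ℝ, E) x y) (g := f) (f := (extChartAt 𝓘(ℝ, E) x).symm) hf hφ hinv v
  exact this.symm

theorem contMDiffAt_extend_of_mem (v : TangentSpace 𝓘(ℝ, E) x) {y : M}
    (hy : y ∈ (chartAt E x).source) : CMDiffAt ∞ (T% (extend E v)) y := by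
  have hy' := mem_baseSet_of_mem_source hy
  rw [Trivialization.contMDiffAt_section_iff (e := trivializationAt E (TangentSpace 𝓘(ℝ, E)) x) hy']
  have : ContMDiffAt 𝓘(ℝ, E) 𝓘(ℝ, E) ∞ (fun _ : M ↦ (show E from v)) y := contMDiffAt_const
  refine this.congr_of_eventuallyEq ?_
  filter_upwards [(chartAt E x).open_source.mem_nhds hy] with z hz
  have hz' := mem_baseSet_of_mem_source hz
  rw [extend_eq_symmL v hz]
  exact (congrArg (fun w ↦ (trivializationAt E (TangentSpace 𝓘(ℝ, E)) x ⟨z, w⟩).2)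
    (Trivialization.symmL_apply _ hz' (show E from v))).trans
    (congrArg Prod.snd (Trivialization.apply_mk_symm _ hz' (show E from v)))

/-- The constant vector field on a normed space. -/
def constField (u : E) : Π z : E, TangentSpace 𝓘(ℝ, E) z := fun _ ↦ u

theorem mdifferentiableAt_constField (u z : E) : MDiffAt (T% (constField u)) z := by
  rw [mdifferentiableAt_section]
  have : (fun b : E ↦ (trivializationAt E (TangentSpace 𝓘(ℝ, E)) z ⟨b, constField u b⟩).2) =
      fun _ ↦ u := by
    funext b
    exact congr($(tangentBundleCore_coordChange_model_space (𝕜 := ℝ) (I := 𝓘(ℝ, E)) b z b) u)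
  rw [this]
  exact mdifferentiableAt_const

theorem mlieBracket_constField (u v z : E) :
    mlieBracket 𝓘(ℝ, E) (constField u) (constField v) z = 0 := by
  rw [← mlieBracketWithin_univ, mlieBracketWithin_eq_lieBracketWithin]
  change lieBracketWithin ℝ (fun _ : E ↦ u) (fun _ ↦ v) Set.univ z = 0
  simp [lieBracketWithin]

theorem extend_eq_mpullback (v : TangentSpace 𝓘(ℝ, E) x) {y : M}
    (hy : y ∈ (chartAt E x).source) :
    extend E v y = mpullback 𝓘(ℝ, E) 𝓘(ℝ, E) (extChartAt 𝓘(ℝ, E) x)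
      (constField (show E from v)) y := by
  have hy' : y ∈ (extChartAt 𝓘(ℝ, E) x).source := by simpa using hy
  have h1 := mfderiv_extChartAt_comp_mfderivWithin_extChartAt_symm' (I := 𝓘(ℝ, E)) hy'
  have h2 := isInvertible_mfderiv_extChartAt (I := 𝓘(ℝ, E)) hy'
  rw [ModelWithCorners.range_eq_univ, mfderivWithin_univ] at h1
  rw [extend_eq_mfderiv_symm v hy]
  change _ = (mfderiv 𝓘(ℝ, E) 𝓘(ℝ, E) (extChartAt 𝓘(ℝ, E) x) y).inverse (v : E)
  obtain ⟨e, he⟩ := h2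
  rw [← he] at h1 ⊢
  rw [ContinuousLinearMap.inverse_equiv]
  exact (e.symm_apply_eq.2 (congr($h1 v)).symm).symm

/-- Both fields are pullbacks of constant fields by the chart, and pullback respects brackets. This
removes the bracket terms from curvature and torsion. -/
theorem mlieBracket_extend [CompleteSpace E] (v w : TangentSpace 𝓘(ℝ, E) x) {y : M}
    (hy : y ∈ (chartAt E x).source) :
    mlieBracket 𝓘(ℝ, E) (extend E v) (extend E w) y = 0 := by
  have h : ∀ u : TangentSpace 𝓘(ℝ, E) x, extend (F := E) (E := TangentSpace 𝓘(ℝ, E)) u =ᶠ[𝓝 y]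
      mpullback 𝓘(ℝ, E) 𝓘(ℝ, E) (extChartAt 𝓘(ℝ, E) x) (constField (show E from u)) := fun u ↦
    Filter.eventually_of_mem ((chartAt E x).open_source.mem_nhds hy)
      fun z hz ↦ extend_eq_mpullback u hz
  have : IsManifold 𝓘(ℝ, E) (minSmoothness ℝ 2) M := by
    rw [minSmoothness_of_isRCLikeNormedField]
    infer_instance
  rw [(h v).mlieBracket_vectorField_eq (h w),
    ← mpullback_mlieBracket (mdifferentiableAt_constField _ _)
      (mdifferentiableAt_constField _ _) (n := 2) ((contMDiffOn_extChartAt (I := 𝓘(ℝ, E)) (n := 2)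
      (x := x)).contMDiffAt ((chartAt E x).open_source.mem_nhds hy)) (by simp), mpullback_apply,
    mlieBracket_constField, map_zero]

/-- Derivatives along coordinate fields commute. -/
theorem mvfderiv_mvfderiv_extend_comm {f : M → W} (hf : ContMDiffAt 𝓘(ℝ, E) 𝓘(ℝ, W) 2 f x)
    (u v : TangentSpace 𝓘(ℝ, E) x) :
    mvfderiv 𝓘(ℝ, E) (fun y ↦ mvfderiv 𝓘(ℝ, E) f y (extend E v y)) x u =
      mvfderiv 𝓘(ℝ, E) (fun y ↦ mvfderiv 𝓘(ℝ, E) f y (extend E u y)) x v := by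
  have hφ : ContMDiffAt 𝓘(ℝ, E) 𝓘(ℝ, E) 2 (extChartAt 𝓘(ℝ, E) x).symm (extChartAt 𝓘(ℝ, E) x x) :=
    (contMDiffOn_extChartAt_symm (I := 𝓘(ℝ, E)) (n := 2) x).contMDiffAt
      ((isOpen_extChartAt_target (I := 𝓘(ℝ, E)) x).mem_nhds (mem_extChartAt_target x))
  have hg : ContDiffAt ℝ 2 (fun z ↦ f ((extChartAt 𝓘(ℝ, E) x).symm z)) (extChartAt 𝓘(ℝ, E) x x) := by
    rw [← contMDiffAt_iff_contDiffAt]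
    exact ContMDiffAt.comp_of_eq (g := f) (y := x) hf hφ (extChartAt_to_inv x)
  have hev : ∀ᶠ y in 𝓝 x, MDiffAt f y := by
    filter_upwards [(contMDiffAt_iff_contMDiffAt_nhds (by simp)).1 hf] with y hy
    exact hy.mdifferentiableAt two_ne_zero
  -- In the chart the iterated derivative is a second Fréchet derivative, which is symmetric for a
  -- C² function.
  have key : ∀ u v : TangentSpace 𝓘(ℝ, E) x,
      mvfderiv 𝓘(ℝ, E) (fun y ↦ mvfderiv 𝓘(ℝ, E) f y (extend E v y)) x u =
        fderiv ℝ (fderiv ℝ (fun z ↦ f ((extChartAt 𝓘(ℝ, E) x).symm z)))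
          (extChartAt 𝓘(ℝ, E) x x) u v := fun u v ↦ by
    have h1 : (fun y ↦ mvfderiv 𝓘(ℝ, E) f y (extend E v y)) =ᶠ[𝓝 x]
        (fun z ↦ fderiv ℝ (fun z ↦ f ((extChartAt 𝓘(ℝ, E) x).symm z)) z
          (show E from v)) ∘ (extChartAt 𝓘(ℝ, E) x) := by
      filter_upwards [hev, chart_source_mem_nhds E x] with y hy hy'
      exact mvfderiv_extend v hy' hy
    have hd : DifferentiableAt ℝ (fderiv ℝ (fun z ↦ f ((extChartAt 𝓘(ℝ, E) x).symm z)))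
        (extChartAt 𝓘(ℝ, E) x x) :=
      (hg.fderiv_right (m := 1) le_rfl).differentiableAt one_ne_zero
    have hd' : DifferentiableAt ℝ (fun z' ↦ fderiv ℝ (fun z ↦ f ((extChartAt 𝓘(ℝ, E) x).symm z)) z'
        (show E from v)) (extChartAt 𝓘(ℝ, E) x x) := hd.clm_apply (differentiableAt_const _)
    have h2 : MDiffAt (fun y ↦ mvfderiv 𝓘(ℝ, E) f y (extend E v y)) x :=
      h1.mdifferentiableAt_iff.2 (hd'.mdifferentiableAt.comp x
        (mdifferentiableAt_extChartAt (mem_chart_source E x)))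
    have h3 := mvfderiv_extend u (mem_chart_source E x) h2
    rw [extend_apply_self] at h3
    rw [h3]
    have h4 : (fun z ↦ mvfderiv 𝓘(ℝ, E) f ((extChartAt 𝓘(ℝ, E) x).symm z)
        (extend E v ((extChartAt 𝓘(ℝ, E) x).symm z))) =ᶠ[𝓝 (extChartAt 𝓘(ℝ, E) x x)]
        fun z' ↦ fderiv ℝ (fun z ↦ f ((extChartAt 𝓘(ℝ, E) x).symm z)) z' (show E from v) := by
      have hc : Filter.Tendsto (extChartAt 𝓘(ℝ, E) x).symm (𝓝 (extChartAt 𝓘(ℝ, E) x x)) (𝓝 x) := by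
        have := continuousAt_extChartAt_symm (I := 𝓘(ℝ, E)) x
        rwa [ContinuousAt, extChartAt_to_inv] at this
      filter_upwards [hc.eventually h1,
        (isOpen_extChartAt_target (I := 𝓘(ℝ, E)) x).mem_nhds (mem_extChartAt_target x)] with z hz hz'
      exact hz.trans (congrArg (fun z' ↦ fderiv ℝ (fun z ↦ f ((extChartAt 𝓘(ℝ, E) x).symm z)) z'
        (show E from v)) ((extChartAt 𝓘(ℝ, E) x).right_inv hz'))
    rw [h4.fderiv_eq, fderiv_clm_apply hd (differentiableAt_const _), fderiv_const_apply,
      ContinuousLinearMap.comp_zero, zero_add]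
    rfl
  rw [key, key]
  exact (hg.isSymmSndFDerivAt (by simp)).eq _ _

end Coordinate

/-! ### Locally smooth vector fields and smooth connections -/

section LocallySmooth

variable {E : Type*} [NormedAddCommGroup E] [NormedSpace ℝ E]
  {M : Type*} [TopologicalSpace M] [ChartedSpace E M] [IsManifold 𝓘(ℝ, E) ∞ M]
  {x : M} {X Y : Π y : M, TangentSpace 𝓘(ℝ, E) y}

/-- The vector field `X` is smooth in a neighbourhood of `x`. -/
def SmoothNear (X : Π y : M, TangentSpace 𝓘(ℝ, E) y) (x : M) : Prop :=
  ∀ᶠ y in 𝓝 x, CMDiffAt ∞ (T% X) y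

theorem SmoothNear.contMDiffAt (h : SmoothNear X x) : CMDiffAt ∞ (T% X) x :=
  h.self_of_nhds

theorem SmoothNear.mdifferentiableAt (h : SmoothNear X x) : MDiffAt (T% X) x :=
  h.contMDiffAt.mdifferentiableAt (by simp)

theorem SmoothNear.eventually (h : SmoothNear X x) : ∀ᶠ y in 𝓝 x, SmoothNear X y :=
  eventually_eventually_nhds.2 h

theorem smoothNear_extend_of_mem (v : TangentSpace 𝓘(ℝ, E) x) {y : M}
    (hy : y ∈ (chartAt E x).source) : SmoothNear (extend E v) y :=
  Filter.eventually_of_mem ((chartAt E x).open_source.mem_nhds hy)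
    fun _ hz ↦ contMDiffAt_extend_of_mem v hz

theorem smoothNear_extend (v : TangentSpace 𝓘(ℝ, E) x) : SmoothNear (extend E v) x :=
  smoothNear_extend_of_mem v (mem_chart_source E x)

variable (D : CovariantDerivative 𝓘(ℝ, E) E (TangentSpace 𝓘(ℝ, E) : M → Type _))

theorem cov_congr (hX : MDiffAt (T% X) x) (hY : MDiffAt (T% Y) x) (h : X =ᶠ[𝓝 x] Y) :
    D X x = D Y x :=
  D.isCovariantDerivativeOnUniv.congr_of_eventuallyEq hX hY Filter.univ_mem h

theorem cov_congr' (hX : MDiffAt (T% X) x) (h : X =ᶠ[𝓝 x] Y) : D X x = D Y x := by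
  refine cov_congr D hX (hX.congr_of_eventuallyEq ?_) h
  filter_upwards [h] with y hy
  rw [hy]

theorem cov_add (hX : MDiffAt (T% X) x) (hY : MDiffAt (T% Y) x) :
    D (X + Y) x = D X x + D Y x :=
  D.isCovariantDerivativeOnUniv.add hX hY

theorem cov_smul_const (c : ℝ) (hX : MDiffAt (T% X) x) : D (c • X) x = c • D X x :=
  D.isCovariantDerivativeOnUniv.smul_const c hX

theorem cov_neg (hX : MDiffAt (T% X) x) : D (-X) x = -D X x := by
  have := cov_smul_const D (-1) hX
  simpa using this

theorem cov_sub (hX : MDiffAt (T% X) x) (hY : MDiffAt (T% Y) x) :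
    D (X - Y) x = D X x - D Y x := by
  rw [sub_eq_add_neg, cov_add D hX (mdifferentiableAt_neg_section hY), cov_neg D hY, sub_eq_add_neg]

variable [FiniteDimensional ℝ E] [T2Space M]

/-- Smoothness of `D` is applied to globally smooth fields, so `X` is first multiplied by a bump
function supported where `X` is smooth. Near `x` the bump is one, and locality of `D` shows that
nothing has changed there. -/
theorem SmoothNear.cov_section (hD : D.ContMDiffCovariantDerivative ∞) (hX : SmoothNear X x) :
    ContMDiffAt 𝓘(ℝ, E) (𝓘(ℝ, E).prod 𝓘(ℝ, E →L[ℝ] E)) ∞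
      (fun y ↦ TotalSpace.mk' (E →L[ℝ] E)
        (E := fun y : M ↦ TangentSpace 𝓘(ℝ, E) y →L[ℝ] TangentSpace 𝓘(ℝ, E) y) y (D X y)) x := by
  obtain ⟨U, hU, hUo, hxU⟩ := eventually_nhds_iff.1 hX
  obtain ⟨f, -, hf⟩ := (SmoothBumpFunction.nhds_basis_tsupport (I := 𝓘(ℝ, E)) x).mem_iff.1
    (hUo.mem_nhds hxU)
  have hfX : CMDiff ∞ (T% ((f : M → ℝ) • X)) :=
    ContMDiffOn.smul_section_of_tsupport f.contMDiff.contMDiffOn hUo hf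
      fun y hy ↦ (hU y hy).contMDiffWithinAt
  have h1 := (hD.contMDiff.contMDiff (σ := (f : M → ℝ) • X) (by simpa using hfX.contMDiffOn)
    x (Set.mem_univ x)).contMDiffAt Filter.univ_mem
  refine h1.congr_of_eventuallyEq ?_
  filter_upwards [f.eventuallyEq_one.eventually_nhds, hX] with y hy hXy
  have : D X y = D ((f : M → ℝ) • X) y := by
    refine cov_congr' D (hXy.mdifferentiableAt (by simp)) ?_
    filter_upwards [hy] with z hz
    change X z = f z • X z
    rw [hz]
    exact (one_smul ℝ _).symm
  rw [this]

theorem SmoothNear.cov (hD : D.ContMDiffCovariantDerivative ∞) (hX : SmoothNear X x)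
    (hY : SmoothNear Y x) : SmoothNear (fun y ↦ D X y (Y y)) x := by
  filter_upwards [hX.eventually, hY] with y hXy hYy
  exact (hXy.cov_section D hD).clm_bundle_apply hYy

theorem mdifferentiableAt_cov (hD : D.ContMDiffCovariantDerivative ∞) (hX : SmoothNear X x)
    (hY : SmoothNear Y x) : MDiffAt (T% (fun y ↦ D X y (Y y))) x :=
  (hX.cov D hD hY).mdifferentiableAt

end LocallySmooth

/-! ### The curvature of a metric connection -/

section Curvature

theorem two_le_infty : (2 : ℕ∞ω) ≤ ∞ := WithTop.coe_le_coe.2 le_top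

variable {E : Type*} [NormedAddCommGroup E] [NormedSpace ℝ E] [FiniteDimensional ℝ E]
  {M : Type*} [TopologicalSpace M] [T2Space M] [ChartedSpace E M] [IsManifold 𝓘(ℝ, E) ∞ M]
  {x : M} {X Y Z : Π y : M, TangentSpace 𝓘(ℝ, E) y}
  (D : CovariantDerivative 𝓘(ℝ, E) E (TangentSpace 𝓘(ℝ, E) : M → Type _))

/-- The curvature along the coordinate fields extending `u` and `v`, applied to a vector field. -/
def curvOn (u v : TangentSpace 𝓘(ℝ, E) x) (Z : Π y : M, TangentSpace 𝓘(ℝ, E) y) :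
    TangentSpace 𝓘(ℝ, E) x :=
  D (fun y ↦ D Z y (extend E v y)) x u - D (fun y ↦ D Z y (extend E u y)) x v

theorem curvature_eq_curvOn (u v w : TangentSpace 𝓘(ℝ, E) x) :
    curvature D x u v w = curvOn D u v (extend E w) := by
  have : CompleteSpace E := FiniteDimensional.complete ℝ E
  rw [curvature, mlieBracket_extend u v (mem_chart_source E x), map_zero, sub_zero, curvOn]

theorem curvature_swap (u v w : TangentSpace 𝓘(ℝ, E) x) :
    curvature D x u v w = -curvature D x v u w := by
  simp only [curvature_eq_curvOn, curvOn, neg_sub]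

variable {D}

theorem curvature_add_left (hD : D.ContMDiffCovariantDerivative ∞)
    (u u' v w : TangentSpace 𝓘(ℝ, E) x) :
    curvature D x (u + u') v w = curvature D x u v w + curvature D x u' v w := by
  have hw := smoothNear_extend w
  have h1 : D (fun y ↦ D (extend E w) y (extend E (u + u') y)) x =
      D (fun y ↦ D (extend E w) y (extend E u y)) x
        + D (fun y ↦ D (extend E w) y (extend E u' y)) x := by
    rw [← cov_add D (mdifferentiableAt_cov D hD hw (smoothNear_extend u))
      (mdifferentiableAt_cov D hD hw (smoothNear_extend u'))]
    refine cov_congr' D (mdifferentiableAt_cov D hD hw (smoothNear_extend _)) ?_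
    filter_upwards [chart_source_mem_nhds E x] with y hy
    rw [extend_add_apply _ _ hy, map_add]
    rfl
  simp only [curvature_eq_curvOn, curvOn, h1, map_add, _root_.add_apply]
  abel

theorem curvature_smul_left (hD : D.ContMDiffCovariantDerivative ∞) (c : ℝ)
    (u v w : TangentSpace 𝓘(ℝ, E) x) :
    curvature D x (c • u) v w = c • curvature D x u v w := by
  have hw := smoothNear_extend w
  have h1 : D (fun y ↦ D (extend E w) y (extend E (c • u) y)) x =
      c • D (fun y ↦ D (extend E w) y (extend E u y)) x := by
    rw [← cov_smul_const D c (mdifferentiableAt_cov D hD hw (smoothNear_extend u))]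
    refine cov_congr' D (mdifferentiableAt_cov D hD hw (smoothNear_extend _)) ?_
    filter_upwards [chart_source_mem_nhds E x] with y hy
    rw [extend_smul_apply _ _ hy, map_smul]
    rfl
  simp only [curvature_eq_curvOn, curvOn, h1, map_smul, _root_.smul_apply, smul_sub]

variable [RiemannianBundle (fun x : M ↦ TangentSpace 𝓘(ℝ, E) x)]
  [IsContMDiffRiemannianBundle 𝓘(ℝ, E) ∞ E (fun x : M ↦ TangentSpace 𝓘(ℝ, E) x)]

theorem contMDiffAt_inner (hY : CMDiffAt ∞ (T% Y) x) (hZ : CMDiffAt ∞ (T% Z) x) :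
    ContMDiffAt 𝓘(ℝ, E) 𝓘(ℝ, ℝ) ∞ (fun y ↦ (inner ℝ (Y y) (Z y) : ℝ)) x :=
  ContMDiffAt.inner_bundle (E := fun x : M ↦ TangentSpace 𝓘(ℝ, E) x) (b := id) hY hZ

theorem mvfderiv_inner
    (hm : CovariantDerivative.IsMetricCompatible (V := fun x : M ↦ TangentSpace 𝓘(ℝ, E) x) D)
    (hY : MDiffAt (T% Y) x) (hZ : MDiffAt (T% Z) x) (u : TangentSpace 𝓘(ℝ, E) x) :
    mvfderiv 𝓘(ℝ, E) (fun y ↦ (inner ℝ (Y y) (Z y) : ℝ)) x u =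
      inner ℝ (D Y x u) (Z x) + inner ℝ (Y x) (D Z x u) := by
  have := hm.mvfderiv_inner_eq (extend E u) hY hZ
  simpa using this

/-- Coordinate derivatives of g(Y,Z) commute. Expanding both orders by metric compatibility, the
mixed products of first derivatives are symmetric in `u`, `v` and cancel. -/
theorem inner_curvOn
    (hm : CovariantDerivative.IsMetricCompatible (V := fun x : M ↦ TangentSpace 𝓘(ℝ, E) x) D)
    (hD : D.ContMDiffCovariantDerivative ∞) (hY : SmoothNear Y x) (hZ : SmoothNear Z x)
    (u v : TangentSpace 𝓘(ℝ, E) x) :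
    (inner ℝ (curvOn D u v Y) (Z x) : ℝ) = -inner ℝ (Y x) (curvOn D u v Z) := by
  have key : ∀ u v : TangentSpace 𝓘(ℝ, E) x,
      mvfderiv 𝓘(ℝ, E) (fun y ↦ mvfderiv 𝓘(ℝ, E) (fun y ↦ (inner ℝ (Y y) (Z y) : ℝ)) y
        (extend E v y)) x u =
      inner ℝ (D (fun y ↦ D Y y (extend E v y)) x u) (Z x) + inner ℝ (D Y x v) (D Z x u)
        + (inner ℝ (D Y x u) (D Z x v)
          + inner ℝ (Y x) (D (fun y ↦ D Z y (extend E v y)) x u)) := fun u v ↦ by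
    have hv := smoothNear_extend v
    have hYv := mdifferentiableAt_cov D hD hY hv
    have hZv := mdifferentiableAt_cov D hD hZ hv
    have h1 : (fun y ↦ mvfderiv 𝓘(ℝ, E) (fun y ↦ (inner ℝ (Y y) (Z y) : ℝ)) y (extend E v y))
        =ᶠ[𝓝 x] fun y ↦ (inner ℝ (D Y y (extend E v y)) (Z y) : ℝ)
          + inner ℝ (Y y) (D Z y (extend E v y)) := by
      filter_upwards [hY.eventually, hZ.eventually] with y hYy hZy
      exact mvfderiv_inner hm hYy.mdifferentiableAt hZy.mdifferentiableAt _
    rw [mvfderiv_congr h1, mvfderiv_fun_add (mdifferentiableAt_inner hYv hZ.mdifferentiableAt)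
      (mdifferentiableAt_inner hY.mdifferentiableAt hZv), _root_.add_apply,
      mvfderiv_inner hm hYv hZ.mdifferentiableAt, mvfderiv_inner hm hY.mdifferentiableAt hZv]
    simp
  have hcomm := mvfderiv_mvfderiv_extend_comm
    ((contMDiffAt_inner hY.contMDiffAt hZ.contMDiffAt).of_le two_le_infty) u v
  rw [key, key] at hcomm
  simp only [curvOn, inner_sub_left, inner_sub_right]
  linarith

/-- By `inner_curvOn`, the pairing of the left side with any vector depends on `Z` only through its
value at `x`. Tensoriality of the curvature thus follows from metric compatibility, without a
Leibniz computation. -/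
theorem curvOn_eq_curvature
    (hm : CovariantDerivative.IsMetricCompatible (V := fun x : M ↦ TangentSpace 𝓘(ℝ, E) x) D)
    (hD : D.ContMDiffCovariantDerivative ∞) (hZ : SmoothNear Z x)
    (u v : TangentSpace 𝓘(ℝ, E) x) : curvOn D u v Z = curvature D x u v (Z x) := by
  refine ext_inner_right ℝ fun w ↦ ?_
  have h1 := inner_curvOn hm hD hZ (smoothNear_extend w) u v
  have h2 := inner_curvOn hm hD (smoothNear_extend (Z x)) (smoothNear_extend w) u v
  rw [extend_apply_self] at h1 h2
  rw [extend_apply_self] at h2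
  rw [curvature_eq_curvOn, h1, h2]

theorem inner_curvature_swap
    (hm : CovariantDerivative.IsMetricCompatible (V := fun x : M ↦ TangentSpace 𝓘(ℝ, E) x) D)
    (hD : D.ContMDiffCovariantDerivative ∞) (u v w z : TangentSpace 𝓘(ℝ, E) x) :
    (inner ℝ (curvature D x u v w) z : ℝ) = -inner ℝ (curvature D x u v z) w := by
  have h := inner_curvOn hm hD (smoothNear_extend w) (smoothNear_extend z) u v
  rw [extend_apply_self, extend_apply_self] at h
  rw [curvature_eq_curvOn, curvature_eq_curvOn, h, real_inner_comm]

end Curvature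

/-! ### Connections preserving the almost complex structure. -/

section ComplexStructure

variable {E : Type*} [NormedAddCommGroup E] [NormedSpace ℝ E] [FiniteDimensional ℝ E]
  {M : Type*} [TopologicalSpace M] [T2Space M] [ChartedSpace E M] [IsManifold 𝓘(ℝ, E) ∞ M]
  [RiemannianBundle (fun x : M ↦ TangentSpace 𝓘(ℝ, E) x)]
  {x : M} {Y : Π y : M, TangentSpace 𝓘(ℝ, E) y} (S : AlmostHermitian E M)
  {D : CovariantDerivative 𝓘(ℝ, E) E (TangentSpace 𝓘(ℝ, E) : M → Type _)}

theorem AlmostHermitian.smoothNear_J (hY : SmoothNear Y x) :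
    SmoothNear (fun y ↦ S.J y (Y y)) x := by
  filter_upwards [hY] with y hy
  exact (S.smooth_J y).clm_bundle_apply hy

theorem AlmostHermitian.mdifferentiableAt_J (hY : MDiffAt (T% Y) x) :
    MDiffAt (T% (fun y ↦ S.J y (Y y))) x :=
  ((S.smooth_J x).mdifferentiableAt (by simp)).clm_bundle_apply hY

/-- The assumption `hJ` concerns coordinate extensions only. The defect is tensorial in `Y`, so it
vanishes for all differentiable fields, in particular for fields that are themselves covariant
derivatives. -/
theorem AlmostHermitian.cov_J (hJ : ∀ (x : M) (u v : TangentSpace 𝓘(ℝ, E) x),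
    covDerivEnd D S.J x u v = 0) (hY : MDiffAt (T% Y) x) (u : TangentSpace 𝓘(ℝ, E) x) :
    D (fun y ↦ S.J y (Y y)) x u = S.J x (D Y x u) := by
  have ht : TensorialAt 𝓘(ℝ, E) E
      (fun Y : Π y : M, TangentSpace 𝓘(ℝ, E) y ↦
        D (fun y ↦ S.J y (Y y)) x u - S.J x (D Y x u)) x :=
    { smul := fun {f Y} hf hY ↦ by
        have h1 : (fun y ↦ S.J y ((f • Y) y)) = f • fun y ↦ S.J y (Y y) := by
          funext y; simp
        rw [h1, D.isCovariantDerivativeOnUniv.leibniz (S.mdifferentiableAt_J hY) hf,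
          D.isCovariantDerivativeOnUniv.leibniz hY hf]
        simp [smul_sub]
      add := fun {Y Y'} hY hY' ↦ by
        have h1 : (fun y ↦ S.J y ((Y + Y') y)) =
            (fun y ↦ S.J y (Y y)) + fun y ↦ S.J y (Y' y) := by
          funext y; simp
        rw [h1, cov_add D (S.mdifferentiableAt_J hY) (S.mdifferentiableAt_J hY'),
          cov_add D hY hY']
        simp only [_root_.add_apply, map_add]
        abel }
  have h := ht.pointwise hY (smoothNear_extend (Y x)).mdifferentiableAt (extend_apply_self _ _).symm
  have h0 := hJ x u (Y x)
  rw [covDerivEnd] at h0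
  exact sub_eq_zero.1 (h.trans h0)

variable [IsContMDiffRiemannianBundle 𝓘(ℝ, E) ∞ E (fun x : M ↦ TangentSpace 𝓘(ℝ, E) x)]

theorem AlmostHermitian.curvature_J (hJ : ∀ (x : M) (u v : TangentSpace 𝓘(ℝ, E) x),
    covDerivEnd D S.J x u v = 0)
    (hm : CovariantDerivative.IsMetricCompatible (V := fun x : M ↦ TangentSpace 𝓘(ℝ, E) x) D)
    (hD : D.ContMDiffCovariantDerivative ∞) (u v w : TangentSpace 𝓘(ℝ, E) x) :
    curvature D x u v (S.J x w) = S.J x (curvature D x u v w) := by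
  have hw := smoothNear_extend w
  -- J applied to a coordinate field need not be a coordinate field, so tensoriality is what relates
  -- it to the curvature at `J w`.
  have h1 := curvOn_eq_curvature hm hD (S.smoothNear_J hw) u v
  rw [extend_apply_self] at h1
  have key : ∀ u v : TangentSpace 𝓘(ℝ, E) x,
      D (fun y ↦ D (fun y ↦ S.J y (extend E w y)) y (extend E v y)) x u =
        S.J x (D (fun y ↦ D (extend E w) y (extend E v y)) x u) := fun u v ↦ by
    have hv := smoothNear_extend v
    rw [← S.cov_J hJ (mdifferentiableAt_cov D hD hw hv)]
    congr 1
    refine cov_congr' D (mdifferentiableAt_cov D hD (S.smoothNear_J hw) hv) ?_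
    filter_upwards [hw.eventually] with y hy
    exact S.cov_J hJ hy.mdifferentiableAt _
  rw [← h1, curvature_eq_curvOn, curvOn, curvOn, key, key, map_sub]

end ComplexStructure

/-! ### Local coordinate frames -/

section Frame

variable {E : Type*} [NormedAddCommGroup E] [NormedSpace ℝ E] [FiniteDimensional ℝ E]
  {M : Type*} [TopologicalSpace M] [ChartedSpace E M] [IsManifold 𝓘(ℝ, E) ∞ M]
  {x : M} {ι : Type*}

/-- The coordinate fields extending a basis of the tangent space at `x` form a basis near `x`, and
the coefficients of a vector field in it are as differentiable as the field. -/
theorem exists_frame (b : Module.Basis ι ℝ (TangentSpace 𝓘(ℝ, E) x)) :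
    ∃ c : ι → Π y : M, TangentSpace 𝓘(ℝ, E) y →ₗ[ℝ] ℝ,
      (∀ Y : Π y : M, TangentSpace 𝓘(ℝ, E) y, MDiffAt (T% Y) x →
        ∀ i, MDiffAt (fun y ↦ c i y (Y y)) x) ∧
      (∀ y ∈ (chartAt E x).source, ∃ B : Module.Basis ι ℝ (TangentSpace 𝓘(ℝ, E) y),
        ∀ i, B i = extend E (b i) y ∧ ∀ w, c i y w = B.repr w i) ∧
      ∀ Y : Π y : M, TangentSpace 𝓘(ℝ, E) y, CMDiffAt ∞ (T% Y) x →
        ∀ i, ContMDiffAt 𝓘(ℝ, E) 𝓘(ℝ, ℝ) ∞ (fun y ↦ c i y (Y y)) x := by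
  let bE : Module.Basis ι ℝ E := b
  let t := trivializationAt E (TangentSpace 𝓘(ℝ, E)) x
  have hx := mem_baseSet_of_mem_source (mem_chart_source E x)
  refine ⟨t.localFrameCoeff 𝓘(ℝ, E) bE, fun Y hY i ↦ mdifferentiableAt_localFrameCoeff bE hx hY i,
    fun y hy ↦ ?_, fun Y hY i ↦ contMDiffAt_localFrameCoeff bE hx hY i⟩
  have hy' := mem_baseSet_of_mem_source hy
  refine ⟨t.basisAt bE hy', fun i ↦ ⟨?_, fun w ↦ ?_⟩⟩
  · rw [extend_eq_symmL _ hy]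
    exact (Trivialization.symmL_apply (R := ℝ) t hy' (bE i)).symm
  · have := t.localFrameCoeff_apply_of_mem_baseSet (I := 𝓘(ℝ, E)) bE hy'
      (extend (E := TangentSpace 𝓘(ℝ, E)) E w) i
    rwa [extend_apply_self] at this

theorem mdifferentiableAt_sum {W κ : Type*} [NormedAddCommGroup W] [NormedSpace ℝ W]
    (s : Finset κ) {f : κ → M → W} (hf : ∀ i ∈ s, MDiffAt (f i) x) :
    MDiffAt (fun y ↦ ∑ i ∈ s, f i y) x := by
  classical
  induction s using Finset.induction_on with
  | empty => simpa using mdifferentiableAt_const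
  | insert a s ha ih =>
    rw [Finset.forall_mem_insert] at hf
    simp only [Finset.sum_insert ha]
    exact hf.1.add (ih hf.2)

theorem mvfderiv_sum {W κ : Type*} [NormedAddCommGroup W] [NormedSpace ℝ W] (s : Finset κ)
    {f : κ → M → W} (hf : ∀ i ∈ s, MDiffAt (f i) x) :
    mvfderiv 𝓘(ℝ, E) (fun y ↦ ∑ i ∈ s, f i y) x = ∑ i ∈ s, mvfderiv 𝓘(ℝ, E) (f i) x := by
  classical
  induction s using Finset.induction_on with
  | empty => simpa using mvfderiv_const (I := 𝓘(ℝ, E)) (0 : W) (x := x)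
  | insert a s ha ih =>
    rw [Finset.forall_mem_insert] at hf
    simp only [Finset.sum_insert ha]
    rw [mvfderiv_fun_add hf.1 (mdifferentiableAt_sum s hf.2), ih hf.2]

variable (D : CovariantDerivative 𝓘(ℝ, E) E (TangentSpace 𝓘(ℝ, E) : M → Type _))

theorem cov_sum_smul {κ : Type*} (s : Finset κ) {f : κ → M → ℝ}
    {X : κ → Π y : M, TangentSpace 𝓘(ℝ, E) y} (hf : ∀ i ∈ s, MDiffAt (f i) x)
    (hX : ∀ i ∈ s, MDiffAt (T% (X i)) x) :
    D (fun y ↦ ∑ i ∈ s, f i y • X i y) x =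
      ∑ i ∈ s, (f i x • D (X i) x + (mvfderiv 𝓘(ℝ, E) (f i) x).smulRight (X i x)) := by
  classical
  induction s using Finset.induction_on with
  | empty =>
    simp only [Finset.sum_empty]
    exact congrFun D.zero x
  | insert a s ha ih =>
    rw [Finset.forall_mem_insert] at hf hX
    simp only [Finset.sum_insert ha]
    rw [← ih hf.2 hX.2, ← D.isCovariantDerivativeOnUniv.leibniz hX.1 hf.1]
    exact cov_add D (hf.1.smul_section hX.1)
      (MDifferentiableAt.sum_section fun i hi ↦ (hf.2 i hi).smul_section (hX.2 i hi))

/-- If an endomorphism field has trace zero near `x`, so does its covariant derivative at `x`. -/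
theorem sum_repr_cov_eq_zero
    (A : Π y : M, TangentSpace 𝓘(ℝ, E) y →ₗ[ℝ] TangentSpace 𝓘(ℝ, E) y)
    [Fintype ι] (b : Module.Basis ι ℝ (TangentSpace 𝓘(ℝ, E) x))
    (hA : ∀ i, MDiffAt (T% (fun y ↦ A y (extend E (b i) y))) x)
    (htr : ∀ᶠ y in 𝓝 x, LinearMap.trace ℝ _ (A y) = 0) (u : TangentSpace 𝓘(ℝ, E) x) :
    ∑ i, b.repr (D (fun y ↦ A y (extend E (b i) y)) x u - A x (D (extend E (b i)) x u)) i = 0 := by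
  classical
  obtain ⟨c, hc, hB, -⟩ := exists_frame b
  have hE : ∀ i, MDiffAt (T% (extend E (b i))) x := fun i ↦ mdifferentiableAt_extend ..
  have hcx : ∀ i (w : TangentSpace 𝓘(ℝ, E) x), c i x w = b.repr w i := fun i w ↦ by
    obtain ⟨B, hB'⟩ := hB x (mem_chart_source E x)
    have : B = b := Module.Basis.eq_of_apply_eq fun i ↦ by rw [(hB' i).1, extend_apply_self]
    rw [(hB' i).2, this]
  have htr' : (fun y ↦ ∑ i, c i y (A y (extend E (b i) y))) =ᶠ[𝓝 x] fun _ ↦ 0 := by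
    filter_upwards [htr, chart_source_mem_nhds E x] with y hy hy'
    obtain ⟨B, hB'⟩ := hB y hy'
    rw [← hy, LinearMap.trace_eq_matrix_trace ℝ B, Matrix.trace]
    refine Finset.sum_congr rfl fun i _ ↦ ?_
    rw [Matrix.diag_apply, LinearMap.toMatrix_apply, (hB' i).1, (hB' i).2]
  have h0 : ∑ i, mvfderiv 𝓘(ℝ, E) (fun y ↦ c i y (A y (extend E (b i) y))) x u = 0 := by
    have h := congr($(mvfderiv_congr htr') u)
    rw [mvfderiv_sum _ fun i _ ↦ hc _ (hA i) i, mvfderiv_const] at h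
    simpa using h
  have hD : ∀ i, D (fun y ↦ A y (extend E (b i) y)) x u =
      ∑ j, (b.repr (A x (b i)) j • D (extend E (b j)) x u
        + mvfderiv 𝓘(ℝ, E) (fun y ↦ c j y (A y (extend E (b i) y))) x u • b j) := fun i ↦ by
    have h : (fun y ↦ A y (extend E (b i) y)) =ᶠ[𝓝 x]
        fun y ↦ ∑ j, c j y (A y (extend E (b i) y)) • extend E (b j) y := by
      filter_upwards [chart_source_mem_nhds E x] with y hy'
      obtain ⟨B, hB'⟩ := hB y hy'
      simp only [fun j ↦ (hB' j).2, ← fun j ↦ (hB' j).1]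
      exact (B.sum_repr _).symm
    refine congr($(cov_congr' D (hA i) h) u).trans (congr($(cov_sum_smul D Finset.univ
      (X := fun j ↦ extend E (b j)) (fun j _ ↦ hc _ (hA i) j) fun j _ ↦ hE j) u).trans ?_)
    simp [hcx]
  have h1 : ∀ i, b.repr (D (fun y ↦ A y (extend E (b i) y)) x u) i =
      ∑ j, b.repr (A x (b i)) j * b.repr (D (extend E (b j)) x u) i
        + mvfderiv 𝓘(ℝ, E) (fun y ↦ c i y (A y (extend E (b i) y))) x u := fun i ↦ by
    rw [hD i, map_sum, Finset.sum_apply']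
    simp [Finset.sum_add_distrib, Finsupp.single_apply]
  have h2 : ∀ i, b.repr (A x (D (extend E (b i)) x u)) i =
      ∑ j, b.repr (D (extend E (b i)) x u) j * b.repr (A x (b j)) i := fun i ↦ by
    conv_lhs => rw [← b.sum_repr (D (extend E (b i)) x u)]
    simp only [map_sum, map_smul, Finsupp.coe_finsetSum, Finset.sum_apply, Finsupp.smul_apply,
      smul_eq_mul]
  simp only [map_sub, Finsupp.sub_apply, h1, h2, Finset.sum_sub_distrib, Finset.sum_add_distrib, h0]
  -- What remains is the trace of a commutator between the matrix of `A` and that of the connection: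
  -- the two double sums agree after exchanging indices.
  rw [add_zero, sub_eq_zero, Finset.sum_comm]
  simp only [mul_comm]

end Frame

/-! ### Tensoriality of the covariant derivative of a three-form -/

section ThreeForms

variable {V W : Type*} [AddCommGroup V] [Module ℝ V] [TopologicalSpace V]
  [NormedAddCommGroup W] [NormedSpace ℝ W] (η : V [⋀^Fin 3]→L[ℝ] W)

theorem form_swap_left (a b c : V) : η ![b, a, c] = -η ![a, b, c] := by
  have := η.toAlternatingMap.map_swap ![a, b, c] (i := 0) (j := 1) (by decide)
  rw [show ![a, b, c] ∘ Equiv.swap (0 : Fin 3) 1 = ![b, a, c] from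
    funext fun i ↦ by fin_cases i <;> rfl] at this
  exact this

theorem form_swap_right (a b c : V) : η ![a, c, b] = -η ![a, b, c] := by
  have := η.toAlternatingMap.map_swap ![a, b, c] (i := 1) (j := 2) (by decide)
  rw [show ![a, b, c] ∘ Equiv.swap (1 : Fin 3) 2 = ![a, c, b] from
    funext fun i ↦ by fin_cases i <;> rfl] at this
  exact this

end ThreeForms

section ThreeFormFields

variable {E : Type*} [NormedAddCommGroup E] [NormedSpace ℝ E] [FiniteDimensional ℝ E]
  {M : Type*} [TopologicalSpace M] [ChartedSpace E M] [IsManifold 𝓘(ℝ, E) ∞ M]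
  {W : Type*} [NormedAddCommGroup W] [NormedSpace ℝ W]
  {x : M} {A B C : Π y : M, TangentSpace 𝓘(ℝ, E) y}
  {η : Π x : M, TangentSpace 𝓘(ℝ, E) x [⋀^Fin 3]→L[ℝ] W}
  (D : CovariantDerivative 𝓘(ℝ, E) E (TangentSpace 𝓘(ℝ, E) : M → Type _))

theorem IsSmoothForm.contMDiffAt_apply (hη : IsSmoothForm η) (hA : CMDiffAt ∞ (T% A) x)
    (hB : CMDiffAt ∞ (T% B) x) (hC : CMDiffAt ∞ (T% C) x) :
    ContMDiffAt 𝓘(ℝ, E) 𝓘(ℝ, W) ∞ (fun y ↦ η y ![A y, B y, C y]) x := by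
  have h := hη x ![A, B, C] (by
    rw [Fin.forall_fin_succ, Fin.forall_fin_two]
    exact ⟨hA, hB, hC⟩)
  refine h.congr_of_eventuallyEq (Filter.Eventually.of_forall fun y ↦ ?_)
  change η y _ = η y _
  congr 1
  funext i
  fin_cases i <;> rfl

theorem form_sum_left {V κ : Type*} [AddCommGroup V] [Module ℝ V] [TopologicalSpace V]
    (α : V [⋀^Fin 3]→L[ℝ] W) (s : Finset κ) (f : κ → ℝ) (v : κ → V) (b c : V) :
    α ![∑ i ∈ s, f i • v i, b, c] = ∑ i ∈ s, f i • α ![v i, b, c] := by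
  classical
  induction s using Finset.induction_on with
  | empty =>
    have := α.vecCons_smul ![b, c] 0 0
    simpa using this
  | insert a s ha ih =>
    rw [Finset.sum_insert ha, Finset.sum_insert ha, α.vecCons_add, α.vecCons_smul, ih]

/-- `IsSmoothForm` tests smooth fields only, whereas tensoriality quantifies over differentiable
ones. Expanding `A` in a coordinate frame leaves differentiable coefficients times smooth functions.
-/
theorem IsSmoothForm.mdifferentiableAt_apply (hη : IsSmoothForm η) (hA : MDiffAt (T% A) x)
    (hB : CMDiffAt ∞ (T% B) x) (hC : CMDiffAt ∞ (T% C) x) :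
    MDiffAt (fun y ↦ η y ![A y, B y, C y]) x := by
  obtain ⟨c, hc, hb, -⟩ := exists_frame (Module.finBasis ℝ (TangentSpace 𝓘(ℝ, E) x))
  have h : (fun y ↦ η y ![A y, B y, C y]) =ᶠ[𝓝 x] fun y ↦ ∑ i, c i y (A y) •
      η y ![extend E (Module.finBasis ℝ (TangentSpace 𝓘(ℝ, E) x) i) y, B y, C y] := by
    filter_upwards [chart_source_mem_nhds E x] with y hy
    obtain ⟨b, hb'⟩ := hb y hy
    rw [← form_sum_left]
    congr 2
    simp only [fun i ↦ (hb' i).2, ← fun i ↦ (hb' i).1]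
    exact (b.sum_repr _).symm
  refine h.mdifferentiableAt_iff.2 (mdifferentiableAt_sum _ fun i _ ↦ (hc A hA i).smul ?_)
  exact (hη.contMDiffAt_apply (contMDiffAt_extend ..) hB hC).mdifferentiableAt (by simp)

theorem contMDiffAt_form_of_extend_left
    (h : ∀ a : TangentSpace 𝓘(ℝ, E) x,
      ContMDiffAt 𝓘(ℝ, E) 𝓘(ℝ, W) ∞ (fun y ↦ η y ![extend E a y, B y, C y]) x)
    (hA : CMDiffAt ∞ (T% A) x) :
    ContMDiffAt 𝓘(ℝ, E) 𝓘(ℝ, W) ∞ (fun y ↦ η y ![A y, B y, C y]) x := by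
  obtain ⟨c, -, hb, hc⟩ := exists_frame (Module.finBasis ℝ (TangentSpace 𝓘(ℝ, E) x))
  have h1 : (fun y ↦ η y ![A y, B y, C y]) =ᶠ[𝓝 x] fun y ↦ ∑ i, c i y (A y) •
      η y ![extend E (Module.finBasis ℝ (TangentSpace 𝓘(ℝ, E) x) i) y, B y, C y] := by
    filter_upwards [chart_source_mem_nhds E x] with y hy
    obtain ⟨b, hb'⟩ := hb y hy
    rw [← form_sum_left]
    congr 2
    simp only [fun i ↦ (hb' i).2, ← fun i ↦ (hb' i).1]
    exact (b.sum_repr _).symm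
  refine ContMDiffAt.congr_of_eventuallyEq ?_ h1
  exact contMDiffAt_finsetSum fun i _ ↦ (hc A hA i).smul (h _)

/-- A three-form is smooth if its values on coordinate fields are smooth. -/
theorem isSmoothForm_of_extend (h : ∀ (x : M) (a b c : TangentSpace 𝓘(ℝ, E) x),
    ContMDiffAt 𝓘(ℝ, E) 𝓘(ℝ, W) ∞ (fun y ↦ η y ![extend E a y, extend E b y, extend E c y]) x) :
    IsSmoothForm η := by
  intro x X hX
  -- Only the first slot can be freed from coordinate fields directly. Cyclic rotations, which are
  -- even, bring each slot to the front in turn.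
  have hrot : ∀ (y : M) (a b c : TangentSpace 𝓘(ℝ, E) y), η y ![b, c, a] = η y ![a, b, c] :=
    fun y a b c ↦ by rw [form_swap_right _ b a c, form_swap_left _ a b c, neg_neg]
  have h1 : ∀ b c : TangentSpace 𝓘(ℝ, E) x, ContMDiffAt 𝓘(ℝ, E) 𝓘(ℝ, W) ∞
      (fun y ↦ η y ![X 0 y, extend E b y, extend E c y]) x := fun b c ↦
    contMDiffAt_form_of_extend_left (fun a ↦ h x a b c) (hX 0)
  have h2 : ∀ c : TangentSpace 𝓘(ℝ, E) x, ContMDiffAt 𝓘(ℝ, E) 𝓘(ℝ, W) ∞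
      (fun y ↦ η y ![X 1 y, extend E c y, X 0 y]) x := fun c ↦
    contMDiffAt_form_of_extend_left (fun b ↦
      by simpa only [fun y b c ↦ hrot y (X 0 y) b c] using h1 b c) (hX 1)
  have h3 : ContMDiffAt 𝓘(ℝ, E) 𝓘(ℝ, W) ∞ (fun y ↦ η y ![X 2 y, X 0 y, X 1 y]) x :=
    contMDiffAt_form_of_extend_left
      (fun c ↦ by simpa only [fun y a b ↦ hrot y (X 1 y) a b] using h2 c) (hX 2)
  simp only [← fun y ↦ hrot y (X 2 y) (X 0 y) (X 1 y)] at h3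
  refine h3.congr_of_eventuallyEq (Filter.Eventually.of_forall fun y ↦ ?_)
  change η y _ = η y _
  congr 1
  funext i
  fin_cases i <;> rfl

/-- The covariant derivative of a three-form, as computed from three vector fields. -/
def covDerivFields (η : Π x : M, TangentSpace 𝓘(ℝ, E) x [⋀^Fin 3]→L[ℝ] W) (x : M)
    (u : TangentSpace 𝓘(ℝ, E) x) (A B C : Π y : M, TangentSpace 𝓘(ℝ, E) y) : W :=
  mvfderiv 𝓘(ℝ, E) (fun y ↦ η y ![A y, B y, C y]) x u
    - (η x ![D A x u, B x, C x] + η x ![A x, D B x u, C x] + η x ![A x, B x, D C x u])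

theorem covDerivForm_eq_covDerivFields (u a b c : TangentSpace 𝓘(ℝ, E) x) :
    covDerivForm D η x u ![a, b, c] = covDerivFields D η x u (extend E a) (extend E b) (extend E c) := by
  have h1 : (fun y ↦ η y (fun i ↦ extend E (![a, b, c] i) y)) =
      fun y ↦ η y ![extend E a y, extend E b y, extend E c y] := by
    funext y
    congr 1
    funext i
    fin_cases i <;> rfl
  rw [covDerivForm, covDerivFields, h1, Fin.sum_univ_three]
  simp only [extend_apply_self]
  congr 4
  · funext i; fin_cases i <;> rfl
  · funext i; fin_cases i <;> rfl
  · funext i; fin_cases i <;> rfl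

theorem covDerivFields_swap_left (u : TangentSpace 𝓘(ℝ, E) x) :
    covDerivFields D η x u B A C = -covDerivFields D η x u A B C := by
  have h : (fun y ↦ η y ![B y, A y, C y]) = -fun y ↦ η y ![A y, B y, C y] :=
    funext fun y ↦ form_swap_left ..
  rw [covDerivFields, covDerivFields, h, mvfderiv_neg, form_swap_left (η x) (A x) (D B x u),
    form_swap_left (η x) (D A x u) (B x), form_swap_left (η x) (A x) (B x)]
  simp only [_root_.neg_apply]
  abel

theorem covDerivFields_swap_right (u : TangentSpace 𝓘(ℝ, E) x) :
    covDerivFields D η x u A C B = -covDerivFields D η x u A B C := by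
  have h : (fun y ↦ η y ![A y, C y, B y]) = -fun y ↦ η y ![A y, B y, C y] :=
    funext fun y ↦ form_swap_right ..
  rw [covDerivFields, covDerivFields, h, mvfderiv_neg, form_swap_right (η x) (D A x u) (B x),
    form_swap_right (η x) (A x) (B x), form_swap_right (η x) (A x) (D B x u)]
  simp only [_root_.neg_apply]
  abel

/-- On replacing `A` by fA, the derivative of f in the leading term cancels the one in ∇(fA), so the
expression is tensorial in `A`. -/
theorem covDerivFields_congr_left (hη : IsSmoothForm η) {A' : Π y : M, TangentSpace 𝓘(ℝ, E) y}
    (hA : MDiffAt (T% A) x) (hA' : MDiffAt (T% A') x) (hB : CMDiffAt ∞ (T% B) x)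
    (hC : CMDiffAt ∞ (T% C) x) (h : A x = A' x) (u : TangentSpace 𝓘(ℝ, E) x) :
    covDerivFields D η x u A B C = covDerivFields D η x u A' B C := by
  have ht : TensorialAt 𝓘(ℝ, E) E
      (fun A : Π y : M, TangentSpace 𝓘(ℝ, E) y ↦ covDerivFields D η x u A B C) x :=
    { smul := fun {f A} hf hA ↦ by
        have h1 : (fun y ↦ η y ![(f • A) y, B y, C y]) =
            fun y ↦ f y • η y ![A y, B y, C y] :=
          funext fun y ↦ (η y).vecCons_smul ..
        rw [covDerivFields, h1, mvfderiv_fun_smul hf (hη.mdifferentiableAt_apply hA hB hC),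
          D.isCovariantDerivativeOnUniv.leibniz hA hf, covDerivFields]
        simp only [_root_.add_apply, _root_.smul_apply, ContinuousLinearMap.smulRight_apply,
          Pi.smul_apply', ContinuousAlternatingMap.vecCons_add,
          ContinuousAlternatingMap.vecCons_smul]
        module
      add := fun {A A'} hA hA' ↦ by
        have h1 : (fun y ↦ η y ![(A + A') y, B y, C y]) =
            fun y ↦ η y ![A y, B y, C y] + η y ![A' y, B y, C y] :=
          funext fun y ↦ (η y).vecCons_add ..
        rw [covDerivFields, h1, mvfderiv_fun_add (hη.mdifferentiableAt_apply hA hB hC)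
          (hη.mdifferentiableAt_apply hA' hB hC), cov_add D hA hA', covDerivFields, covDerivFields]
        simp only [_root_.add_apply, Pi.add_apply, ContinuousAlternatingMap.vecCons_add]
        abel }
  exact ht.pointwise hA hA' h

/-- The three fields are exchanged for coordinate fields one at a time, each brought to the front by
transpositions. Parallelism can then be used on fields such as ∇_v A. -/
theorem covDerivFields_eq_covDerivForm (hη : IsSmoothForm η) (hA : CMDiffAt ∞ (T% A) x)
    (hB : CMDiffAt ∞ (T% B) x) (hC : CMDiffAt ∞ (T% C) x) (u : TangentSpace 𝓘(ℝ, E) x) :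
    covDerivFields D η x u A B C = covDerivForm D η x u ![A x, B x, C x] := by
  have he : ∀ v : TangentSpace 𝓘(ℝ, E) x, CMDiffAt ∞ (T% (extend E v)) x :=
    fun v ↦ contMDiffAt_extend ..
  have hd : ∀ {Y : Π y : M, TangentSpace 𝓘(ℝ, E) y}, CMDiffAt ∞ (T% Y) x → MDiffAt (T% Y) x :=
    fun h ↦ h.mdifferentiableAt (by simp)
  have h1 := covDerivFields_congr_left D hη (hd hA) (hd (he (A x))) hB hC (by simp) u
  have h2 := covDerivFields_congr_left D hη (hd hB) (hd (he (B x))) (he (A x)) hC (by simp) u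
  have h3 := covDerivFields_congr_left D hη (hd hC) (hd (he (C x))) (he (A x)) (he (B x)) (by simp) u
  have s1 : ∀ A B C : Π y : M, TangentSpace 𝓘(ℝ, E) y,
      covDerivFields D η x u B A C = -covDerivFields D η x u A B C :=
    fun _ _ _ ↦ covDerivFields_swap_left ..
  have s2 : ∀ A B C : Π y : M, TangentSpace 𝓘(ℝ, E) y,
      covDerivFields D η x u A C B = -covDerivFields D η x u A B C :=
    fun _ _ _ ↦ covDerivFields_swap_right ..
  rw [covDerivForm_eq_covDerivFields, h1, s1, h2, s1, neg_neg, s2, s1, h3, s1, s2]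
  simp only [neg_neg]

/-! ### Parallel three-forms and curvature. -/

variable [T2Space M] {D}

theorem IsSmoothForm.mvfderiv_of_parallel (hη : IsSmoothForm η)
    (hp : ∀ (x : M) (u : TangentSpace 𝓘(ℝ, E) x) (v : Fin 3 → TangentSpace 𝓘(ℝ, E) x),
      covDerivForm D η x u v = 0) (hA : SmoothNear A x) (hB : SmoothNear B x)
    (hC : SmoothNear C x) (u : TangentSpace 𝓘(ℝ, E) x) :
    mvfderiv 𝓘(ℝ, E) (fun y ↦ η y ![A y, B y, C y]) x u =
      η x ![D A x u, B x, C x] + η x ![A x, D B x u, C x] + η x ![A x, B x, D C x u] := by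
  have h := covDerivFields_eq_covDerivForm D hη hA.contMDiffAt hB.contMDiffAt hC.contMDiffAt u
  rw [hp, covDerivFields] at h
  exact sub_eq_zero.1 h

/-- The last six terms are grouped into pairs symmetric in `u` and `v`, so that they drop out of the
commutator of derivatives and only curvature survives. -/
theorem IsSmoothForm.mvfderiv_mvfderiv_of_parallel (hη : IsSmoothForm η)
    (hD : D.ContMDiffCovariantDerivative ∞)
    (hp : ∀ (x : M) (u : TangentSpace 𝓘(ℝ, E) x) (v : Fin 3 → TangentSpace 𝓘(ℝ, E) x),
      covDerivForm D η x u v = 0) (hA : SmoothNear A x) (hB : SmoothNear B x)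
    (hC : SmoothNear C x) (u v : TangentSpace 𝓘(ℝ, E) x) :
    mvfderiv 𝓘(ℝ, E) (fun y ↦ mvfderiv 𝓘(ℝ, E) (fun y ↦ η y ![A y, B y, C y]) y
        (extend E v y)) x u =
      η x ![D (fun y ↦ D A y (extend E v y)) x u, B x, C x]
        + η x ![A x, D (fun y ↦ D B y (extend E v y)) x u, C x]
        + η x ![A x, B x, D (fun y ↦ D C y (extend E v y)) x u]
        + ((η x ![D A x v, D B x u, C x] + η x ![D A x u, D B x v, C x])
        + (η x ![D A x v, B x, D C x u] + η x ![D A x u, B x, D C x v])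
        + (η x ![A x, D B x v, D C x u] + η x ![A x, D B x u, D C x v])) := by
  have hv := smoothNear_extend v
  have hAv := hA.cov D hD hv
  have hBv := hB.cov D hD hv
  have hCv := hC.cov D hD hv
  have h1 : (fun y ↦ mvfderiv 𝓘(ℝ, E) (fun y ↦ η y ![A y, B y, C y]) y (extend E v y))
      =ᶠ[𝓝 x] fun y ↦ η y ![D A y (extend E v y), B y, C y]
        + η y ![A y, D B y (extend E v y), C y] + η y ![A y, B y, D C y (extend E v y)] := by
    filter_upwards [hA.eventually, hB.eventually, hC.eventually] with y hAy hBy hCy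
    exact hη.mvfderiv_of_parallel hp hAy hBy hCy _
  have d : ∀ {A B C : Π y : M, TangentSpace 𝓘(ℝ, E) y}, SmoothNear A x → SmoothNear B x →
      SmoothNear C x → MDiffAt (fun y ↦ η y ![A y, B y, C y]) x := fun hA hB hC ↦
    hη.mdifferentiableAt_apply hA.mdifferentiableAt hB.contMDiffAt hC.contMDiffAt
  have d2 : MDiffAt (fun y ↦ η y ![D A y (extend E v y), B y, C y]
      + η y ![A y, D B y (extend E v y), C y]) x := (d hAv hB hC).add (d hA hBv hC)
  rw [mvfderiv_congr h1, mvfderiv_fun_add d2 (d hA hB hCv),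
    mvfderiv_fun_add (d hAv hB hC) (d hA hBv hC), _root_.add_apply, _root_.add_apply,
    hη.mvfderiv_of_parallel hp hAv hB hC, hη.mvfderiv_of_parallel hp hA hBv hC,
    hη.mvfderiv_of_parallel hp hA hB hCv]
  simp only [extend_apply_self]
  abel

/-- The curvature of a connection annihilates every parallel three-form. -/
theorem form_curvature (hη : IsSmoothForm η) (hD : D.ContMDiffCovariantDerivative ∞)
    (hp : ∀ (x : M) (u : TangentSpace 𝓘(ℝ, E) x) (v : Fin 3 → TangentSpace 𝓘(ℝ, E) x),
      covDerivForm D η x u v = 0) (u v a b c : TangentSpace 𝓘(ℝ, E) x) :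
    η x ![curvature D x u v a, b, c] + η x ![a, curvature D x u v b, c]
      + η x ![a, b, curvature D x u v c] = 0 := by
  have ha := smoothNear_extend a
  have hb := smoothNear_extend b
  have hc := smoothNear_extend c
  have h := mvfderiv_mvfderiv_extend_comm ((hη.contMDiffAt_apply ha.contMDiffAt hb.contMDiffAt
    hc.contMDiffAt).of_le two_le_infty) u v
  rw [hη.mvfderiv_mvfderiv_of_parallel hD hp ha hb hc,
    hη.mvfderiv_mvfderiv_of_parallel hD hp ha hb hc] at h
  simp only [extend_apply_self] at h
  have e : ∀ a b c, η x ![a, b, c] = η x ![b, c, a] := fun a b c ↦ by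
    rw [form_swap_right _ b a c, form_swap_left _ a b c, neg_neg]
  have l : ∀ p q b c, η x ![p - q, b, c] = η x ![p, b, c] - η x ![q, b, c] := fun p q b c ↦ by
    rw [eq_sub_iff_add_eq, ← (η x).vecCons_add, sub_add_cancel]
  rw [e a (curvature D x u v b), ← e (curvature D x u v c) a b, curvature_eq_curvOn,
    curvature_eq_curvOn, curvature_eq_curvOn, curvOn, curvOn, curvOn, l, l, l, ← e a, ← e a,
    e _ a b, e _ a b]
  rw [← sub_eq_zero] at h
  rw [← h]
  abel

end ThreeFormFields

/-! ### Metric connections with totally skew-symmetric torsion -/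

section SkewTorsion

variable {E : Type*} [NormedAddCommGroup E] [NormedSpace ℝ E] [FiniteDimensional ℝ E]
  {M : Type*} [TopologicalSpace M] [ChartedSpace E M] [IsManifold 𝓘(ℝ, E) ∞ M]
  {x : M} {D : CovariantDerivative 𝓘(ℝ, E) E (TangentSpace 𝓘(ℝ, E) : M → Type _)}

theorem torsion_extend (v w : TangentSpace 𝓘(ℝ, E) x) {y : M} (hy : y ∈ (chartAt E x).source) :
    D.torsion y (extend E v y) (extend E w y) =
      D (extend E w) y (extend E v y) - D (extend E v) y (extend E w y) := by
  have : CompleteSpace E := FiniteDimensional.complete ℝ E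
  rw [D.torsion_apply (smoothNear_extend_of_mem v hy).mdifferentiableAt
    (smoothNear_extend_of_mem w hy).mdifferentiableAt, mlieBracket_extend v w hy, sub_zero]

theorem torsion_eq_cov_extend (v w : TangentSpace 𝓘(ℝ, E) x) :
    D.torsion x v w = D (extend E w) x v - D (extend E v) x w := by
  simpa only [extend_apply_self] using torsion_extend (D := D) v w (mem_chart_source E x)

variable [RiemannianBundle (fun x : M ↦ TangentSpace 𝓘(ℝ, E) x)]

theorem torsionForm_apply (hs : HasSkewTorsion D) (a b c : TangentSpace 𝓘(ℝ, E) x) :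
    torsionForm D hs x ![a, b, c] = inner ℝ (D.torsion x a b) c := rfl

variable [T2Space M]
  [IsContMDiffRiemannianBundle 𝓘(ℝ, E) ∞ E (fun x : M ↦ TangentSpace 𝓘(ℝ, E) x)]

theorem isSmoothForm_torsionForm (hD : D.ContMDiffCovariantDerivative ∞) (hs : HasSkewTorsion D) :
    IsSmoothForm (torsionForm D hs) := by
  refine isSmoothForm_of_extend fun x a b c ↦ ?_
  have ha := smoothNear_extend a
  have hb := smoothNear_extend b
  have hc := (smoothNear_extend c).contMDiffAt
  refine ((contMDiffAt_inner (hb.cov D hD ha).contMDiffAt hc).sub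
    (contMDiffAt_inner (ha.cov D hD hb).contMDiffAt hc)).congr_of_eventuallyEq ?_
  filter_upwards [chart_source_mem_nhds E x] with y hy
  rw [torsionForm_apply, torsion_extend a b hy, inner_sub_left]

theorem mvfderiv_torsionForm (hs : HasSkewTorsion D)
    (u a b c : TangentSpace 𝓘(ℝ, E) x) :
    mvfderiv 𝓘(ℝ, E) (fun y ↦ torsionForm D hs y ![extend E a y, extend E b y, extend E c y]) x u =
      covDerivForm D (torsionForm D hs) x u ![a, b, c]
        + (torsionForm D hs x ![D (extend E a) x u, b, c]
          + torsionForm D hs x ![a, D (extend E b) x u, c]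
          + torsionForm D hs x ![a, b, D (extend E c) x u]) := by
  rw [covDerivForm_eq_covDerivFields, covDerivFields]
  simp only [extend_apply_self]
  abel

theorem covDerivForm_swap_left {η : Π x : M, TangentSpace 𝓘(ℝ, E) x [⋀^Fin 3]→L[ℝ] ℝ}
    (u a b c : TangentSpace 𝓘(ℝ, E) x) :
    covDerivForm D η x u ![b, a, c] = -covDerivForm D η x u ![a, b, c] := by
  rw [covDerivForm_eq_covDerivFields, covDerivFields_swap_left, covDerivForm_eq_covDerivFields]

theorem covDerivForm_swap_right {η : Π x : M, TangentSpace 𝓘(ℝ, E) x [⋀^Fin 3]→L[ℝ] ℝ}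
    (u a b c : TangentSpace 𝓘(ℝ, E) x) :
    covDerivForm D η x u ![a, c, b] = -covDerivForm D η x u ![a, b, c] := by
  rw [covDerivForm_eq_covDerivFields, covDerivFields_swap_right, covDerivForm_eq_covDerivFields]

theorem smoothNear_torsion (hD : D.ContMDiffCovariantDerivative ∞)
    (v w : TangentSpace 𝓘(ℝ, E) x) :
    SmoothNear (fun y ↦ D.torsion y (extend E v y) (extend E w y)) x := by
  have hv := smoothNear_extend v
  have hw := smoothNear_extend w
  filter_upwards [hw.cov D hD hv, hv.cov D hD hw,
    eventually_eventually_nhds.2 (chart_source_mem_nhds E x)] with y h1 h2 h3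
  refine (h1.sub_section h2).congr_of_eventuallyEq ?_
  filter_upwards [h3] with z hz
  exact congrArg (TotalSpace.mk' E z) (torsion_extend v w hz)

theorem inner_cov_torsion (hD : D.ContMDiffCovariantDerivative ∞)
    (hm : CovariantDerivative.IsMetricCompatible (V := fun x : M ↦ TangentSpace 𝓘(ℝ, E) x) D)
    (hs : HasSkewTorsion D) (u v w z : TangentSpace 𝓘(ℝ, E) x) :
    inner ℝ (D (fun y ↦ D.torsion y (extend E v y) (extend E w y)) x u) z =
      covDerivForm D (torsionForm D hs) x u ![v, w, z]
        + torsionForm D hs x ![D (extend E v) x u, w, z]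
        + torsionForm D hs x ![v, D (extend E w) x u, z] := by
  have h := mvfderiv_inner hm (smoothNear_torsion hD v w).mdifferentiableAt
    (smoothNear_extend z).mdifferentiableAt u
  have h' := mvfderiv_torsionForm hs u v w z
  simp only [torsionForm_apply] at h'
  simp only [extend_apply_self] at h h'
  rw [h] at h'
  simp only [torsionForm_apply]
  linarith

/-- The cyclic sum `g(T(a, b), T(c, d)) + g(T(b, c), T(a, d)) + g(T(c, a), T(b, d))`. -/
def torsionSq (D : CovariantDerivative 𝓘(ℝ, E) E (TangentSpace 𝓘(ℝ, E) : M → Type _)) (x : M)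
    (a b c d : TangentSpace 𝓘(ℝ, E) x) : ℝ :=
  inner ℝ (D.torsion x a b) (D.torsion x c d) + inner ℝ (D.torsion x b c) (D.torsion x a d)
    + inner ℝ (D.torsion x c a) (D.torsion x b d)

theorem torsionForm_torsion (hs : HasSkewTorsion D) (a b c d : TangentSpace 𝓘(ℝ, E) x) :
    torsionForm D hs x ![D.torsion x a b, c, d] =
      inner ℝ (D.torsion x a b) (D.torsion x c d) := by
  rw [form_swap_left _ c, form_swap_right _ c d, neg_neg, torsionForm_apply, real_inner_comm]

theorem form_sub_left {η : Π x : M, TangentSpace 𝓘(ℝ, E) x [⋀^Fin 3]→L[ℝ] ℝ}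
    (p q b c : TangentSpace 𝓘(ℝ, E) x) :
    η x ![p - q, b, c] = η x ![p, b, c] - η x ![q, b, c] := by
  rw [eq_sub_iff_add_eq, ← (η x).vecCons_add, sub_add_cancel]

/-- The first Bianchi identity of a metric connection with skew-symmetric torsion. -/
theorem bianchi (hD : D.ContMDiffCovariantDerivative ∞)
    (hm : CovariantDerivative.IsMetricCompatible (V := fun x : M ↦ TangentSpace 𝓘(ℝ, E) x) D)
    (hs : HasSkewTorsion D) (u v w z : TangentSpace 𝓘(ℝ, E) x) :
    (inner ℝ (curvature D x u v w) z + inner ℝ (curvature D x v w u) z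
      + inner ℝ (curvature D x w u v) z : ℝ) =
      covDerivForm D (torsionForm D hs) x u ![v, w, z]
        + covDerivForm D (torsionForm D hs) x v ![w, u, z]
        + covDerivForm D (torsionForm D hs) x w ![u, v, z] + torsionSq D x u v w z := by
  have key : ∀ v w u : TangentSpace 𝓘(ℝ, E) x,
      D (fun y ↦ D.torsion y (extend E v y) (extend E w y)) x u =
        D (fun y ↦ D (extend E w) y (extend E v y)) x u
          - D (fun y ↦ D (extend E v) y (extend E w y)) x u := fun v w u ↦ by
    have h1 := mdifferentiableAt_cov D hD (smoothNear_extend w) (smoothNear_extend v)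
    have h2 := mdifferentiableAt_cov D hD (smoothNear_extend v) (smoothNear_extend w)
    refine congr($(cov_congr' D (smoothNear_torsion hD v w).mdifferentiableAt ?_) u).trans
      congr($(cov_sub D h1 h2) u)
    filter_upwards [chart_source_mem_nhds E x] with y hy
    exact torsion_extend v w hy
  -- For commuting fields T(V,W) = ∇_V W - ∇_W V, so the second derivatives in the cyclic sum
  -- regroup into derivatives of the torsion.
  have h : curvature D x u v w + curvature D x v w u + curvature D x w u v =
      D (fun y ↦ D.torsion y (extend E v y) (extend E w y)) x u
        + D (fun y ↦ D.torsion y (extend E w y) (extend E u y)) x v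
        + D (fun y ↦ D.torsion y (extend E u y) (extend E v y)) x w := by
    rw [key, key, key]
    simp only [curvature_eq_curvOn, curvOn]
    abel
  -- The connection terms left by the Leibniz rule pair into differences ∇_a B - ∇_b A = T(a,b),
  -- which produces the quadratic term.
  have h2 : ∀ a b c : TangentSpace 𝓘(ℝ, E) x, torsionForm D hs x ![D (extend E b) x a, c, z]
      + torsionForm D hs x ![c, D (extend E a) x b, z] =
      inner ℝ (D.torsion x a b) (D.torsion x c z) := fun a b c ↦ by
    rw [← torsionForm_torsion hs, torsion_eq_cov_extend, form_sub_left,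
      form_swap_left _ (D (extend E a) x b) c]
    ring
  rw [← inner_add_left, ← inner_add_left, h, inner_add_left, inner_add_left,
    inner_cov_torsion hD hm hs, inner_cov_torsion hD hm hs, inner_cov_torsion hD hm hs, torsionSq,
    ← h2 u v w, ← h2 v w u, ← h2 w u v]
  ring

/-! ### Comparison with the Levi-Civita connection -/

/-- In the Koszul formula, metric compatibility expands the derivatives and torsion the brackets.
The derivative terms reduce to 2g(∇_u Y,w), and by total skew-symmetry the three torsion terms add
up to -g(T(u,Y),w). -/
theorem leviCivita_eq_sub
    (hm : CovariantDerivative.IsMetricCompatible (V := fun x : M ↦ TangentSpace 𝓘(ℝ, E) x) D)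
    (hs : HasSkewTorsion D) {Y : Π y : M, TangentSpace 𝓘(ℝ, E) y} (hY : MDiffAt (T% Y) x)
    (u : TangentSpace 𝓘(ℝ, E) x) :
    leviCivita 𝓘(ℝ, E) M Y x u = D Y x u - (2⁻¹ : ℝ) • D.torsion x u (Y x) := by
  refine ext_inner_right ℝ fun w ↦ ?_
  have hX := (smoothNear_extend u).mdifferentiableAt
  have hZ := (smoothNear_extend w).mdifferentiableAt
  have h := inner_leviCivita hY hX hZ
  have t1 := D.torsion_apply hX hY
  have t2 := D.torsion_apply hX hZ
  have t3 := D.torsion_apply hY hZ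
  have b1 : mlieBracket 𝓘(ℝ, E) (extend E u) Y x = D Y x (extend E u x) - D (extend E u) x (Y x)
      - D.torsion x (extend E u x) (Y x) := by rw [t1, sub_sub_cancel]
  have b2 : mlieBracket 𝓘(ℝ, E) (extend E u) (extend E w) x = D (extend E w) x (extend E u x)
      - D (extend E u) x (extend E w x) - D.torsion x (extend E u x) (extend E w x) := by
    rw [t2, sub_sub_cancel]
  have b3 : mlieBracket 𝓘(ℝ, E) Y (extend E w) x = D (extend E w) x (Y x)
      - D Y x (extend E w x) - D.torsion x (Y x) (extend E w x) := by rw [t3, sub_sub_cancel]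
  rw [koszul, b1, b2, b3, mvfderiv_inner hm hY hZ, mvfderiv_inner hm hX hZ,
    mvfderiv_inner hm hX hY] at h
  simp only [extend_apply_self, inner_sub_left] at h
  have s1 := hs x u w (Y x)
  have s2 := hs x (Y x) w u
  have s3 : (inner ℝ (D.torsion x (Y x) u) w : ℝ) = -inner ℝ (D.torsion x u (Y x)) w := by
    rw [D.torsion_antisymm, inner_neg_left]
  have c1 := real_inner_comm (Y x) (D (extend E w) x u)
  have c2 := real_inner_comm u (D (extend E w) x (Y x))
  have c3 := real_inner_comm u (D Y x w)
  rw [h, inner_sub_left, inner_smul_left]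
  simp only [conj_trivial]
  linarith

theorem covDerivForm_leviCivita {p : ℕ} {W : Type*} [NormedAddCommGroup W] [NormedSpace ℝ W]
    {η : Π x : M, TangentSpace 𝓘(ℝ, E) x [⋀^Fin p]→L[ℝ] W}
    (hm : CovariantDerivative.IsMetricCompatible (V := fun x : M ↦ TangentSpace 𝓘(ℝ, E) x) D)
    (hs : HasSkewTorsion D) (u : TangentSpace 𝓘(ℝ, E) x) (v : Fin p → TangentSpace 𝓘(ℝ, E) x) :
    covDerivForm (leviCivita 𝓘(ℝ, E) M) η x u v = covDerivForm D η x u v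
      + (2⁻¹ : ℝ) • ∑ i, η x (Function.update v i (D.torsion x u (v i))) := by
  rw [covDerivForm, covDerivForm, Finset.smul_sum, sub_add, ← Finset.sum_sub_distrib]
  congr 1
  refine Finset.sum_congr rfl fun i _ ↦ ?_
  rw [leviCivita_eq_sub hm hs (smoothNear_extend (v i)).mdifferentiableAt, extend_apply_self,
    (η x).map_update_sub, (η x).map_update_smul]

/-- Replacing the Levi-Civita connection by `D` costs terms quadratic in T, which cancel for each
basis vector e: T(e,e) = 0, and the other two are g(T(e,a),T(e,b)) with opposite signs. -/
theorem codifferential_torsionForm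
    (hm : CovariantDerivative.IsMetricCompatible (V := fun x : M ↦ TangentSpace 𝓘(ℝ, E) x) D)
    (hs : HasSkewTorsion D) (a b : TangentSpace 𝓘(ℝ, E) x) :
    codifferential (torsionForm D hs) x ![a, b] =
      -∑ i, covDerivForm D (torsionForm D hs) x (stdOrthonormalBasis ℝ (TangentSpace 𝓘(ℝ, E) x) i)
        ![stdOrthonormalBasis ℝ (TangentSpace 𝓘(ℝ, E) x) i, a, b] := by
  rw [codifferential]
  congr 1
  refine Finset.sum_congr rfl fun i _ ↦ ?_
  generalize stdOrthonormalBasis ℝ (TangentSpace 𝓘(ℝ, E) x) i = e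
  have h0 : ∀ p q r : TangentSpace 𝓘(ℝ, E) x, Function.update ![p, q, r] 0 (D.torsion x e p)
      = ![D.torsion x e p, q, r] := fun p q r ↦ by funext i; fin_cases i <;> rfl
  have h1 : ∀ p q r : TangentSpace 𝓘(ℝ, E) x, Function.update ![p, q, r] 1 (D.torsion x e q)
      = ![p, D.torsion x e q, r] := fun p q r ↦ by funext i; fin_cases i <;> rfl
  have h2 : ∀ p q r : TangentSpace 𝓘(ℝ, E) x, Function.update ![p, q, r] 2 (D.torsion x e r)
      = ![p, q, D.torsion x e r] := fun p q r ↦ by funext i; fin_cases i <;> rfl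
  have hc : (Fin.cons e ![a, b] : Fin 3 → TangentSpace 𝓘(ℝ, E) x) = ![e, a, b] := rfl
  rw [covDerivForm_leviCivita hm hs, hc, Fin.sum_univ_three]
  change _ + (2⁻¹ : ℝ) • (torsionForm D hs x (Function.update ![e, a, b] 0 (D.torsion x e e))
    + torsionForm D hs x (Function.update ![e, a, b] 1 (D.torsion x e a))
    + torsionForm D hs x (Function.update ![e, a, b] 2 (D.torsion x e b))) = _
  rw [h0, h1, h2, torsionForm_apply, torsionForm_apply, torsionForm_apply, D.torsion_self,
    map_zero, hs x e (D.torsion x e a) b]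
  simp [real_inner_comm]

end SkewTorsion

/-! ### The torsion of a balanced structure -/

section Balanced

variable {E : Type*} [NormedAddCommGroup E] [NormedSpace ℝ E] [FiniteDimensional ℝ E]
  {M : Type*} [TopologicalSpace M] [T2Space M] [ChartedSpace E M] [IsManifold 𝓘(ℝ, E) ∞ M]
  [RiemannianBundle (fun x : M ↦ TangentSpace 𝓘(ℝ, E) x)]
  [IsContMDiffRiemannianBundle 𝓘(ℝ, E) ∞ E (fun x : M ↦ TangentSpace 𝓘(ℝ, E) x)]
  {x : M} {D : CovariantDerivative 𝓘(ℝ, E) E (TangentSpace 𝓘(ℝ, E) : M → Type _)}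
  (S : AlmostHermitian E M)

theorem AlmostHermitian.inner_J_left (u v : TangentSpace 𝓘(ℝ, E) x) :
    (inner ℝ (S.J x u) v : ℝ) = -inner ℝ u (S.J x v) := by
  rw [← S.inner_J x u, S.J_sq, inner_neg_right, neg_neg]

theorem AlmostHermitian.covDerivForm_kahlerForm
    (hJ : ∀ (x : M) (u v : TangentSpace 𝓘(ℝ, E) x), covDerivEnd D S.J x u v = 0)
    (hm : CovariantDerivative.IsMetricCompatible (V := fun x : M ↦ TangentSpace 𝓘(ℝ, E) x) D)
    (u a b : TangentSpace 𝓘(ℝ, E) x) : covDerivForm D S.kahlerForm x u ![a, b] = 0 := by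
  have hb := smoothNear_extend b
  have h := mvfderiv_inner hm (smoothNear_extend a).mdifferentiableAt
    (S.smoothNear_J hb).mdifferentiableAt u
  rw [S.cov_J hJ hb.mdifferentiableAt] at h
  simp only [extend_apply_self] at h
  rw [covDerivForm, Fin.sum_univ_two]
  exact sub_eq_zero.2 h

/-- The Kähler form is parallel for `D`, so only the correction T/2 between the two connections
contributes to δF. -/
theorem AlmostHermitian.leeForm_eq
    (hJ : ∀ (x : M) (u v : TangentSpace 𝓘(ℝ, E) x), covDerivEnd D S.J x u v = 0)
    (hm : CovariantDerivative.IsMetricCompatible (V := fun x : M ↦ TangentSpace 𝓘(ℝ, E) x) D)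
    (hs : HasSkewTorsion D) (v : TangentSpace 𝓘(ℝ, E) x) :
    S.leeForm x v = -2⁻¹ * ∑ i, inner ℝ (D.torsion x (S.J x v)
      (stdOrthonormalBasis ℝ (TangentSpace 𝓘(ℝ, E) x) i))
      (S.J x (stdOrthonormalBasis ℝ (TangentSpace 𝓘(ℝ, E) x) i)) := by
  rw [leeForm, codifferential, neg_mul, Finset.mul_sum]
  congr 1
  refine Finset.sum_congr rfl fun i _ ↦ ?_
  generalize stdOrthonormalBasis ℝ (TangentSpace 𝓘(ℝ, E) x) i = e
  have hc : (Fin.cons e ![S.J x v] : Fin 2 → TangentSpace 𝓘(ℝ, E) x) = ![e, S.J x v] := rfl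
  rw [covDerivForm_leviCivita hm hs, hc, S.covDerivForm_kahlerForm hJ hm, Fin.sum_univ_two]
  change 0 + (2⁻¹ : ℝ) • (inner ℝ (D.torsion x e e) (S.J x (S.J x v))
    + inner ℝ e (S.J x (D.torsion x e (S.J x v)))) = _
  rw [D.torsion_self, inner_zero_left, zero_add, zero_add, D.torsion_antisymm, map_neg,
    inner_neg_right, ← S.inner_J_left, real_inner_comm, smul_eq_mul]

theorem AlmostHermitian.trace_J_torsion (hb : S.IsBalanced)
    (hJ : ∀ (x : M) (u v : TangentSpace 𝓘(ℝ, E) x), covDerivEnd D S.J x u v = 0)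
    (hm : CovariantDerivative.IsMetricCompatible (V := fun x : M ↦ TangentSpace 𝓘(ℝ, E) x) D)
    (hs : HasSkewTorsion D) (v : TangentSpace 𝓘(ℝ, E) x) :
    LinearMap.trace ℝ _ (S.J x ∘L D.torsion x v :
      TangentSpace 𝓘(ℝ, E) x →L[ℝ] TangentSpace 𝓘(ℝ, E) x).toLinearMap = 0 := by
  -- The choice -Jv makes J(-Jv) = v the torsion argument.
  have h := hb x (-S.J x v)
  rw [S.leeForm_eq hJ hm hs, map_neg, S.J_sq, neg_neg, mul_eq_zero_iff_left (by norm_num)] at h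
  rw [LinearMap.trace_eq_sum_inner _ (stdOrthonormalBasis ℝ (TangentSpace 𝓘(ℝ, E) x)), ← neg_eq_zero,
    ← h, ← Finset.sum_neg_distrib]
  refine Finset.sum_congr rfl fun i _ ↦ ?_
  generalize stdOrthonormalBasis ℝ (TangentSpace 𝓘(ℝ, E) x) i = e
  change -inner ℝ e (S.J x (D.torsion x v e)) = _
  rw [← S.inner_J_left, real_inner_comm]

/-- Up to sign this is the trace of J ∘ (∇_u T)(v,·). Differentiating the trace-free field J ∘
T(V,·) gives that endomorphism plus J ∘ T(∇_u V,·), which is trace-free by the balanced condition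
again. -/
theorem AlmostHermitian.sum_covDerivForm_torsionForm_J (hb : S.IsBalanced)
    (hJ : ∀ (x : M) (u v : TangentSpace 𝓘(ℝ, E) x), covDerivEnd D S.J x u v = 0)
    (hD : D.ContMDiffCovariantDerivative ∞)
    (hm : CovariantDerivative.IsMetricCompatible (V := fun x : M ↦ TangentSpace 𝓘(ℝ, E) x) D)
    (hs : HasSkewTorsion D) {ι : Type*} [Fintype ι]
    (e : OrthonormalBasis ι ℝ (TangentSpace 𝓘(ℝ, E) x)) (u v : TangentSpace 𝓘(ℝ, E) x) :
    ∑ i, covDerivForm D (torsionForm D hs) x u ![v, e i, S.J x (e i)] = 0 := by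
  have hv := smoothNear_extend v
  have hA : ∀ i, MDiffAt (T% (fun y ↦ S.J y (D.torsion y (extend E v y) (extend E (e i) y)))) x :=
    fun i ↦ (S.smoothNear_J (smoothNear_torsion hD v (e i))).mdifferentiableAt
  have h := sum_repr_cov_eq_zero D (fun y ↦ (S.J y ∘L D.torsion y (extend E v y) :
    TangentSpace 𝓘(ℝ, E) y →L[ℝ] TangentSpace 𝓘(ℝ, E) y).toLinearMap) e.toBasis
    (fun i ↦ by simpa using hA i)
    (Filter.Eventually.of_forall fun y ↦ S.trace_J_torsion hb hJ hm hs _) u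
  have h0 := S.trace_J_torsion hb hJ hm hs (D (extend E v) x u)
  rw [LinearMap.trace_eq_sum_inner _ e] at h0
  rw [← neg_eq_zero, ← sub_eq_zero.2 (h.trans h0.symm), ← Finset.sum_sub_distrib,
    ← Finset.sum_neg_distrib]
  refine Finset.sum_congr rfl fun i _ ↦ ?_
  have h1 := S.cov_J hJ (smoothNear_torsion hD v (e i)).mdifferentiableAt u
  have h2 := inner_cov_torsion hD hm hs u v (e i) (S.J x (e i))
  simp only [OrthonormalBasis.coe_toBasis, OrthonormalBasis.coe_toBasis_repr_apply, e.repr_apply_apply]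
  change _ = inner ℝ (e i)
    (D (fun y ↦ S.J y (D.torsion y (extend E v y) (extend E (e i) y))) x u
      - S.J x (D.torsion x (extend E v x) (D (extend E (e i)) x u)))
    - inner ℝ (e i) (S.J x (D.torsion x (D (extend E v) x u) (e i)))
  rw [h1, extend_apply_self, inner_sub_right]
  rw [torsionForm_apply, torsionForm_apply] at h2
  have h3 : ∀ w, (inner ℝ (e i) (S.J x w) : ℝ) = -inner ℝ w (S.J x (e i)) := fun w ↦ by
    rw [← real_inner_comm, S.inner_J_left]
  rw [h3, h3, h3, h2]
  ring

end Balanced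

/-! ### The exterior derivative in coordinate fields -/

section ExteriorDerivative

variable {E : Type*} [NormedAddCommGroup E] [NormedSpace ℝ E] [FiniteDimensional ℝ E] {p : ℕ}

/-- Values on tuples of basis vectors embed the alternating forms linearly into a finite-dimensional
space. A linear left inverse carries differentiability back. -/
theorem differentiableAt_alternating {V : Type*} [NormedAddCommGroup V] [NormedSpace ℝ V]
    {α : V → E [⋀^Fin p]→L[ℝ] ℝ} {z : V}
    (h : ∀ v, DifferentiableAt ℝ (fun y ↦ α y v) z) : DifferentiableAt ℝ α z := by
  let b := Module.finBasis ℝ E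
  let Φ : (E [⋀^Fin p]→L[ℝ] ℝ) →ₗ[ℝ] ((Fin p → Fin (Module.finrank ℝ E)) → ℝ) :=
    { toFun := fun β s ↦ β fun i ↦ b (s i)
      map_add' := fun _ _ ↦ rfl
      map_smul' := fun _ _ ↦ rfl }
  have hΦ : LinearMap.ker Φ = ⊥ := by
    refine LinearMap.ker_eq_bot'.2 fun β hβ ↦ ?_
    refine ContinuousAlternatingMap.toAlternatingMap_injective ?_
    refine AlternatingMap.coe_multilinearMap_injective ?_
    exact Module.Basis.ext_multilinear (fun _ ↦ b) fun s ↦ congrFun hβ s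
  have : FiniteDimensional ℝ (E [⋀^Fin p]→L[ℝ] ℝ) :=
    FiniteDimensional.of_injective Φ (LinearMap.ker_eq_bot.1 hΦ)
  obtain ⟨Ψ, hΨ⟩ := Φ.exists_leftInverse_of_injective hΦ
  have h1 : DifferentiableAt ℝ (fun y ↦ Φ (α y)) z := differentiableAt_pi.2 fun s ↦ h _
  have h2 := (LinearMap.toContinuousLinearMap Ψ).differentiableAt.comp z h1
  refine h2.congr_of_eventuallyEq (Filter.Eventually.of_forall fun y ↦ ?_)
  exact (LinearMap.congr_fun hΨ (α y)).symm

variable {M : Type*} [TopologicalSpace M] [ChartedSpace E M] [IsManifold 𝓘(ℝ, E) ∞ M]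
  {x : M} {η : Π x : M, TangentSpace 𝓘(ℝ, E) x [⋀^Fin p]→L[ℝ] ℝ}

theorem IsSmoothForm.mdifferentiableAt_extend (hη : IsSmoothForm η)
    (v : Fin p → TangentSpace 𝓘(ℝ, E) x) : MDiffAt (fun y ↦ η y fun i ↦ extend E (v i) y) x :=
  (hη x (fun i ↦ extend E (v i)) fun i ↦ (smoothNear_extend (v i)).contMDiffAt).mdifferentiableAt
    (by simp)

/-- Evaluating the form in the chart on constant vectors amounts to evaluating it on coordinate
fields, so the formula for d in a vector space transfers without bracket terms. -/
theorem extDerivForm_apply (hη : IsSmoothForm η) (v : Fin (p + 1) → TangentSpace 𝓘(ℝ, E) x) :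
    extDerivForm η x v = ∑ i, (-1) ^ i.val *
      mvfderiv 𝓘(ℝ, E) (fun y ↦ η y fun j ↦ extend E (i.removeNth v j) y) x (v i) := by
  have hx := mem_chart_source E x
  have hpull : ∀ w : Fin p → E, (fun z ↦ ((η ((extChartAt 𝓘(ℝ, E) x).symm z)).compContinuousLinearMap
      (mfderiv 𝓘(ℝ, E) 𝓘(ℝ, E) (extChartAt 𝓘(ℝ, E) x).symm z)) w) =ᶠ[𝓝 (extChartAt 𝓘(ℝ, E) x x)]
      fun z ↦ η ((extChartAt 𝓘(ℝ, E) x).symm z) fun i ↦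
        extend E (show TangentSpace 𝓘(ℝ, E) x from w i) ((extChartAt 𝓘(ℝ, E) x).symm z) := fun w ↦ by
    filter_upwards [(isOpen_extChartAt_target (I := 𝓘(ℝ, E)) x).mem_nhds (mem_extChartAt_target x)]
      with z hz
    change η _ _ = η _ _
    congr 1
    funext i
    rw [extend_eq_mfderiv_symm _ (by simpa using (extChartAt 𝓘(ℝ, E) x).map_target hz),
      (extChartAt 𝓘(ℝ, E) x).right_inv hz]
    rfl
  have hφ : MDiffAt (extChartAt 𝓘(ℝ, E) x).symm (extChartAt 𝓘(ℝ, E) x x) :=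
    ((contMDiffOn_extChartAt_symm (I := 𝓘(ℝ, E)) (n := 1) x).contMDiffAt
      ((isOpen_extChartAt_target x).mem_nhds (mem_extChartAt_target x))).mdifferentiableAt
        one_ne_zero
  have hd : ∀ w : Fin p → TangentSpace 𝓘(ℝ, E) x, DifferentiableAt ℝ
      (fun z ↦ η ((extChartAt 𝓘(ℝ, E) x).symm z) fun i ↦
        extend E (w i) ((extChartAt 𝓘(ℝ, E) x).symm z)) (extChartAt 𝓘(ℝ, E) x x) := fun w ↦ by
    rw [← mdifferentiableAt_iff_differentiableAt]
    exact MDifferentiableAt.comp_of_eq _ (g := fun y ↦ η y fun i ↦ extend E (w i) y)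
      (hη.mdifferentiableAt_extend w) hφ (extChartAt_to_inv x)
  have hv : (fun i ↦ mfderiv 𝓘(ℝ, E) 𝓘(ℝ, E) (extChartAt 𝓘(ℝ, E) x) x (v i)) = v :=
    funext fun i ↦ mfderiv_extChartAt_self (v i)
  change extDeriv (E := E) _ _ (fun i ↦ mfderiv 𝓘(ℝ, E) 𝓘(ℝ, E) (extChartAt 𝓘(ℝ, E) x) x (v i)) = _
  rw [hv]
  refine (extDeriv_apply (E := E) (F := ℝ) (differentiableAt_alternating (E := E) (V := E)
    fun w ↦ (hd w).congr_of_eventuallyEq (hpull w)) v).trans ?_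
  refine Finset.sum_congr rfl fun i _ ↦ ?_
  have h := mvfderiv_extend (v i) hx (hη.mdifferentiableAt_extend (i.removeNth v))
  rw [extend_apply_self] at h
  refine (congrArg ((-1) ^ i.val • ·)
    (congr($((hpull (i.removeNth v)).fderiv_eq) (v i)).trans h.symm)).trans ?_
  simp

variable [T2Space M] [RiemannianBundle (fun x : M ↦ TangentSpace 𝓘(ℝ, E) x)]
  [IsContMDiffRiemannianBundle 𝓘(ℝ, E) ∞ E (fun x : M ↦ TangentSpace 𝓘(ℝ, E) x)]
  {D : CovariantDerivative 𝓘(ℝ, E) E (TangentSpace 𝓘(ℝ, E) : M → Type _)}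

/-- The twelve connection terms pair into six differences, each a torsion T(a,b). Every product in
`torsionSq` arises twice, once from each of its factors, whence the coefficient 2. -/
theorem extDerivForm_torsionForm (hD : D.ContMDiffCovariantDerivative ∞) (hs : HasSkewTorsion D)
    (a b c d : TangentSpace 𝓘(ℝ, E) x) :
    extDerivForm (torsionForm D hs) x ![a, b, c, d] =
      covDerivForm D (torsionForm D hs) x a ![b, c, d]
        - covDerivForm D (torsionForm D hs) x b ![a, c, d]
        + covDerivForm D (torsionForm D hs) x c ![a, b, d]
        - covDerivForm D (torsionForm D hs) x d ![a, b, c] + 2 * torsionSq D x a b c d := by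
  have hv : ∀ p q r : TangentSpace 𝓘(ℝ, E) x, (fun y ↦ torsionForm D hs y fun j ↦
      extend E (![p, q, r] j) y) = fun y ↦ torsionForm D hs y
        ![extend E p y, extend E q y, extend E r y] := fun p q r ↦ by
    funext y
    congr 1
    funext j
    fin_cases j <;> rfl
  have r0 : (0 : Fin 4).removeNth ![a, b, c, d] = ![b, c, d] := by
    funext j; fin_cases j <;> rfl
  have r1 : (1 : Fin 4).removeNth ![a, b, c, d] = ![a, c, d] := by
    funext j; fin_cases j <;> rfl
  have r2 : (2 : Fin 4).removeNth ![a, b, c, d] = ![a, b, d] := by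
    funext j; fin_cases j <;> rfl
  have r3 : (3 : Fin 4).removeNth ![a, b, c, d] = ![a, b, c] := by
    funext j; fin_cases j <;> rfl
  have e0 := mvfderiv_torsionForm hs a b c d
  have e1 := mvfderiv_torsionForm hs b a c d
  have e2 := mvfderiv_torsionForm hs c a b d
  have e3 := mvfderiv_torsionForm hs d a b c
  have t : ∀ a b c d : TangentSpace 𝓘(ℝ, E) x,
      torsionForm D hs x ![D (extend E b) x a, c, d] - torsionForm D hs x ![D (extend E a) x b, c, d]
        = inner ℝ (D.torsion x a b) (D.torsion x c d) := fun a b c d ↦ by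
    rw [← form_sub_left, ← torsion_eq_cov_extend, torsionForm_torsion]
  have m : ∀ p q r : TangentSpace 𝓘(ℝ, E) x,
      torsionForm D hs x ![q, p, r] = -torsionForm D hs x ![p, q, r] :=
    fun p q r ↦ form_swap_left ..
  have l : ∀ p q r : TangentSpace 𝓘(ℝ, E) x,
      torsionForm D hs x ![q, r, p] = torsionForm D hs x ![p, q, r] := fun p q r ↦ by
    rw [form_swap_right _ q p r, form_swap_left, neg_neg]
  rw [extDerivForm_apply (isSmoothForm_torsionForm hD hs), Fin.sum_univ_four, r0, r1, r2, r3,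
    hv, hv, hv, hv]
  change (-1) ^ 0 * mvfderiv 𝓘(ℝ, E) _ x a + (-1) ^ 1 * mvfderiv 𝓘(ℝ, E) _ x b
    + (-1) ^ 2 * mvfderiv 𝓘(ℝ, E) _ x c + (-1) ^ 3 * mvfderiv 𝓘(ℝ, E) _ x d = _
  rw [e0, e1, e2, e3, torsionSq]
  have t1 := t a b c d
  have t2 := t a c b d
  have t3 := t a d b c
  have t4 := t b c a d
  have t5 := t b d a c
  have t6 := t c d a b
  have c1 := real_inner_comm (D.torsion x a b) (D.torsion x c d)
  have c2 := real_inner_comm (D.torsion x a c) (D.torsion x b d)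
  have c3 := real_inner_comm (D.torsion x a d) (D.torsion x b c)
  have n1 : (inner ℝ (D.torsion x c a) (D.torsion x b d) : ℝ)
      = -inner ℝ (D.torsion x a c) (D.torsion x b d) := by
    rw [D.torsion_antisymm, inner_neg_left]
  rw [n1]
  simp only [m (D _ x _), l (D _ x _)] at *
  linarith

end ExteriorDerivative

/-! ### Ricci curvature and the exterior derivative of the torsion -/

section Ricci

variable {E : Type*} [NormedAddCommGroup E] [NormedSpace ℝ E] [FiniteDimensional ℝ E]
  {M : Type*} [TopologicalSpace M] [T2Space M] [ChartedSpace E M] [IsManifold 𝓘(ℝ, E) ∞ M]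
  [RiemannianBundle (fun x : M ↦ TangentSpace 𝓘(ℝ, E) x)]
  [IsContMDiffRiemannianBundle 𝓘(ℝ, E) ∞ E (fun x : M ↦ TangentSpace 𝓘(ℝ, E) x)]
  {x : M} {D : CovariantDerivative 𝓘(ℝ, E) E (TangentSpace 𝓘(ℝ, E) : M → Type _)}

theorem inner_curvature_neg_left (u v w z : TangentSpace 𝓘(ℝ, E) x) :
    (inner ℝ (curvature D x u v w) z : ℝ) = -inner ℝ (curvature D x v u w) z := by
  rw [curvature_swap, inner_neg_left]

theorem covDerivForm_neg_right {η : Π x : M, TangentSpace 𝓘(ℝ, E) x [⋀^Fin 3]→L[ℝ] ℝ}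
    (hη : IsSmoothForm η) (u a b c : TangentSpace 𝓘(ℝ, E) x) :
    covDerivForm D η x u ![a, b, -c] = -covDerivForm D η x u ![a, b, c] := by
  have h : covDerivForm D η x u ![-c, a, b] = -covDerivForm D η x u ![c, a, b] := by
    have hn : ∀ y : M, ∀ p q r : TangentSpace 𝓘(ℝ, E) y, η y ![-p, q, r] = -η y ![p, q, r] :=
      fun y p q r ↦ by simpa using (η y).vecCons_smul ![q, r] (-1) p
    have h1 := covDerivFields_congr_left D hη (smoothNear_extend (-c)).mdifferentiableAt
      (mdifferentiableAt_neg_section (smoothNear_extend c).mdifferentiableAt)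
      (smoothNear_extend a).contMDiffAt (smoothNear_extend b).contMDiffAt (by simp) u
    have h2 : (fun y ↦ η y ![(-extend E c) y, extend E a y, extend E b y]) =
        -fun y ↦ η y ![extend E c y, extend E a y, extend E b y] := funext fun y ↦ hn ..
    rw [covDerivForm_eq_covDerivFields, h1, covDerivForm_eq_covDerivFields, covDerivFields, h2,
      mvfderiv_neg, cov_neg D (smoothNear_extend c).mdifferentiableAt, covDerivFields]
    simp only [_root_.neg_apply, Pi.neg_apply, hn]
    ring
  rw [covDerivForm_swap_right, covDerivForm_swap_left, neg_neg, h,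
    covDerivForm_swap_left (D := D) (η := η) u a c,
    covDerivForm_swap_right (D := D) (η := η) u a b c, neg_neg]

theorem torsionSq_swap_left (a b c d : TangentSpace 𝓘(ℝ, E) x) :
    torsionSq D x b a c d = -torsionSq D x a b c d := by
  simp only [torsionSq]
  rw [D.torsion_antisymm b a, D.torsion_antisymm a c, D.torsion_antisymm c b]
  simp only [inner_neg_left]
  ring

theorem torsionSq_swap_middle (a b c d : TangentSpace 𝓘(ℝ, E) x) :
    torsionSq D x a c b d = -torsionSq D x a b c d := by
  simp only [torsionSq]
  rw [D.torsion_antisymm b a, D.torsion_antisymm a c, D.torsion_antisymm c b]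
  simp only [inner_neg_left]
  ring

theorem torsionSq_swap_right (a b c d : TangentSpace 𝓘(ℝ, E) x) :
    torsionSq D x a b d c = -torsionSq D x a b c d := by
  simp only [torsionSq]
  rw [D.torsion_antisymm d c, D.torsion_antisymm d a, D.torsion_antisymm c a,
    real_inner_comm (D.torsion x a c), real_inner_comm (D.torsion x b c)]
  simp only [inner_neg_left, inner_neg_right]
  ring

/-- Take the Bianchi identity `b3` and subtract `b4`, `b1` and `b2`. The skew symmetries of R remove
the unwanted curvature terms; the quadratic terms cancel in `b1` + `b2` and double in `b3` - `b4`,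
matching those of dT. -/
theorem curvature_eq_extDerivForm (hD : D.ContMDiffCovariantDerivative ∞)
    (hm : CovariantDerivative.IsMetricCompatible (V := fun x : M ↦ TangentSpace 𝓘(ℝ, E) x) D)
    (hs : HasSkewTorsion D) (a b p q : TangentSpace 𝓘(ℝ, E) x) :
    2 * (inner ℝ (curvature D x p a b) q - inner ℝ (curvature D x q a b) p
      + inner ℝ (curvature D x a b p) q) =
      extDerivForm (torsionForm D hs) x ![a, b, p, q]
        + 2 * covDerivForm D (torsionForm D hs) x a ![b, p, q] := by
  have b1 := bianchi hD hm hs p a q b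
  have b2 := bianchi hD hm hs p b q a
  have b3 := bianchi hD hm hs p a b q
  have b4 := bianchi hD hm hs q a b p
  have R := inner_curvature_swap hm hD (x := x)
  have R' := inner_curvature_neg_left (D := D) (x := x)
  have N := covDerivForm_swap_left (D := D) (η := torsionForm D hs) (x := x)
  have N' := covDerivForm_swap_right (D := D) (η := torsionForm D hs) (x := x)
  have s1 : torsionSq D x p a q b + torsionSq D x p b q a = 0 := by
    rw [torsionSq_swap_right, torsionSq_swap_middle, torsionSq_swap_right]
    ring
  have s2 : torsionSq D x p a b q = torsionSq D x a b p q := by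
    rw [torsionSq_swap_left, torsionSq_swap_middle, neg_neg]
  have s3 : torsionSq D x q a b p = -torsionSq D x a b p q := by
    rw [torsionSq_swap_left, torsionSq_swap_middle, torsionSq_swap_right, neg_neg]
  rw [extDerivForm_torsionForm hD hs]
  linarith [R p a q b, R' a q p b, R q a p b, R p b q a, R' b q p a, R q b p a, R q p b a,
    R' b p a q, R a b q p, R' b q a p, N' p a b q, N a p q b, N' a p b q, N a b p q, N q a p b,
    N' q a b p, N' p b a q, N p a b q, N b p q a, N' b p a q, N b a p q, N q b p a, N' q b a p,
    N q a b p, N' a b p q, N b a q p, N' b a p q]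

/-- The curvature is linear in its first slot, so the Ricci tensor is a trace and may be computed in
an adapted basis. -/
theorem ricci_eq_sum (hD : D.ContMDiffCovariantDerivative ∞) {ι : Type*} [Fintype ι]
    (e : OrthonormalBasis ι ℝ (TangentSpace 𝓘(ℝ, E) x)) (v w : TangentSpace 𝓘(ℝ, E) x) :
    ricci D x v w = ∑ i, inner ℝ (curvature D x (e i) v w) (e i) := by
  let L : TangentSpace 𝓘(ℝ, E) x →ₗ[ℝ] TangentSpace 𝓘(ℝ, E) x :=
    { toFun := fun u ↦ curvature D x u v w
      map_add' := fun u u' ↦ curvature_add_left hD u u' v w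
      map_smul' := fun c u ↦ curvature_smul_left hD c u v w }
  have h1 := L.trace_eq_sum_inner e
  rw [L.trace_eq_sum_inner (stdOrthonormalBasis ℝ (TangentSpace 𝓘(ℝ, E) x))] at h1
  rw [ricci]
  refine (Finset.sum_congr rfl fun i _ ↦ real_inner_comm _ _).trans (h1.trans ?_)
  exact Finset.sum_congr rfl fun i _ ↦ real_inner_comm _ _

/-- Trace the Bianchi identity over its first and last arguments: for each basis vector the
quadratic term and one curvature term vanish by skew-symmetry. -/
theorem codifferential_eq_ricci (hD : D.ContMDiffCovariantDerivative ∞)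
    (hm : CovariantDerivative.IsMetricCompatible (V := fun x : M ↦ TangentSpace 𝓘(ℝ, E) x) D)
    (hs : HasSkewTorsion D) (a b : TangentSpace 𝓘(ℝ, E) x) :
    codifferential (torsionForm D hs) x ![a, b] = ricci D x b a - ricci D x a b := by
  rw [codifferential_torsionForm hm hs, ricci, ricci, ← Finset.sum_sub_distrib,
    ← Finset.sum_neg_distrib]
  refine Finset.sum_congr rfl fun i _ ↦ ?_
  generalize stdOrthonormalBasis ℝ (TangentSpace 𝓘(ℝ, E) x) i = e
  have h := bianchi hD hm hs e a b e
  have N := covDerivForm_swap_left (D := D) (η := torsionForm D hs) (x := x)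
  have N' := covDerivForm_swap_right (D := D) (η := torsionForm D hs) (x := x)
  have h1 := inner_curvature_swap hm hD a b e e
  have h2 := inner_curvature_neg_left (D := D) b e a e
  have h3 := N' a b e e
  have h4 : covDerivForm D (torsionForm D hs) x b ![e, a, e] = 0 := by
    have := N b e a e
    have := N' b a e e
    linarith
  have h5 : covDerivForm D (torsionForm D hs) x e ![a, b, e] =
      covDerivForm D (torsionForm D hs) x e ![e, a, b] := by
    rw [N' e a e b, N e e a b, neg_neg]
  have h6 : torsionSq D x e a b e = 0 := by
    rw [torsionSq, D.torsion_self, inner_zero_right, D.torsion_antisymm a e, inner_neg_right,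
      real_inner_comm]
    ring
  linarith

end Ricci

/-! ### Four-forms in dimension six -/

/-- In dimension six, a four-form is determined by its contraction with the Kähler form. -/
theorem alternating_eq_zero_of_contraction {V : Type*} [AddCommGroup V] [Module ℝ V]
    [TopologicalSpace V] (e : Module.Basis (Fin 3 × Fin 2) ℝ V) (α : V [⋀^Fin 4]→L[ℝ] ℝ)
    (h : ∀ v w, ∑ a, α ![v, w, e (a, 0), e (a, 1)] = 0) : α = 0 := by
  have z : ∀ (i j : Fin 3 × Fin 2) (a : Fin 3), i = j ∨ i.1 = a ∨ j.1 = a →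
      α ![e i, e j, e (a, 0), e (a, 1)] = 0 := by
    rintro ⟨b, k⟩ ⟨c, l⟩ a (h | h | h)
    · rw [h]
      exact α.map_eq_zero_of_eq _ (i := 0) (j := 1) rfl (by decide)
    · obtain rfl : b = a := h
      fin_cases k
      · exact α.map_eq_zero_of_eq _ (i := 0) (j := 2) rfl (by decide)
      · exact α.map_eq_zero_of_eq _ (i := 0) (j := 3) rfl (by decide)
    · obtain rfl : c = a := h
      fin_cases l
      · exact α.map_eq_zero_of_eq _ (i := 1) (j := 2) rfl (by decide)
      · exact α.map_eq_zero_of_eq _ (i := 1) (j := 3) rfl (by decide)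
  have swap : ∀ v w p q, α ![w, v, p, q] = -α ![v, w, p, q] := fun v w p q ↦ by
    have := α.toAlternatingMap.map_swap ![v, w, p, q] (i := 0) (j := 1) (by decide)
    rw [show ![v, w, p, q] ∘ Equiv.swap (0 : Fin 4) 1 = ![w, v, p, q] from
      funext fun i ↦ by fin_cases i <;> rfl] at this
    exact this
  have symm : ∀ v w p q, α ![v, w, p, q] = α ![p, q, v, w] := fun v w p q ↦ by
    have := α.toAlternatingMap.map_perm ![v, w, p, q] (Equiv.swap 0 2 * Equiv.swap 1 3)
    rw [show ![v, w, p, q] ∘ (Equiv.swap (0 : Fin 4) 2 * Equiv.swap 1 3 : Equiv.Perm (Fin 4)) =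
      ![p, q, v, w] from funext fun i ↦ by fin_cases i <;> rfl,
      show Equiv.Perm.sign (Equiv.swap (0 : Fin 4) 2 * Equiv.swap 1 3) = 1 by decide,
      one_smul] at this
    exact this.symm
  -- Contracting on each of the three coordinate planes shows that three numbers have vanishing
  -- pairwise sums, so all are zero.
  have g : ∀ b a, α ![e (b, 0), e (b, 1), e (a, 0), e (a, 1)] = 0 := by
    have h0 := h (e (0, 0)) (e (0, 1))
    have h1 := h (e (1, 0)) (e (1, 1))
    have h2 := h (e (2, 0)) (e (2, 1))
    rw [Fin.sum_univ_three] at h0 h1 h2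
    rw [z _ _ 0 (by simp)] at h0
    rw [z _ _ 1 (by simp), symm] at h1
    rw [z _ _ 2 (by simp), symm, symm (e (2, 0)) _ (e (1, 0))] at h2
    intro b a
    by_cases hab : b = a
    · exact z _ _ _ (by simp [hab])
    fin_cases b <;> fin_cases a <;> first | exact absurd rfl hab | skip
    · change α ![e (0, 0), e (0, 1), e (1, 0), e (1, 1)] = 0
      linarith
    · change α ![e (0, 0), e (0, 1), e (2, 0), e (2, 1)] = 0
      linarith
    · change α ![e (1, 0), e (1, 1), e (0, 0), e (0, 1)] = 0
      rw [symm]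
      linarith
    · change α ![e (1, 0), e (1, 1), e (2, 0), e (2, 1)] = 0
      linarith
    · change α ![e (2, 0), e (2, 1), e (0, 0), e (0, 1)] = 0
      rw [symm]
      linarith
    · change α ![e (2, 0), e (2, 1), e (1, 0), e (1, 1)] = 0
      rw [symm]
      linarith
  have f : ∀ (i j : Fin 3 × Fin 2) (a : Fin 3), α ![e i, e j, e (a, 0), e (a, 1)] = 0 := by
    intro i j a
    by_cases hz : i = j ∨ i.1 = a ∨ j.1 = a
    · exact z i j a hz
    by_cases hij : i.1 = j.1
    · obtain ⟨b, k⟩ := i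
      obtain ⟨c, l⟩ := j
      obtain rfl : b = c := hij
      fin_cases k <;> fin_cases l
      · simp at hz
      · exact g b a
      · exact (swap ..).trans (neg_eq_zero.2 (g b a))
      · simp at hz
    -- Here i, j and a belong to three different pairs, so every other term of the contraction
    -- repeats a basis vector.
    · rw [← h (e i) (e j), Finset.sum_eq_single a]
      · intro c _ hc
        refine z i j c ?_
        push Not at hz
        right
        omega
      · simp
  have perm : ∀ i j : Fin 4, i ≠ j → ∃ σ : Equiv.Perm (Fin 4), σ 2 = i ∧ σ 3 = j := by decide
  refine ContinuousAlternatingMap.toAlternatingMap_injective ?_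
  refine Module.Basis.ext_alternating e fun v hv ↦ ?_
  -- Four distinct basis vectors are spread over three pairs, so one whole pair occurs; a
  -- permutation moves it to the last two slots.
  obtain ⟨i, j, hij, hi⟩ : ∃ i j : Fin 4, i ≠ j ∧ (v i).1 = (v j).1 :=
    Fintype.exists_ne_map_eq_of_card_lt (fun i ↦ (v i).1) (by simp)
  obtain ⟨i, j, a, hij, hi, hj⟩ : ∃ (i j : Fin 4) (a : Fin 3),
      i ≠ j ∧ v i = (a, 0) ∧ v j = (a, 1) := by
    have hne : (v i).2 ≠ (v j).2 := fun h ↦ hij (hv (Prod.ext hi h))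
    have hk : (v i).2 = 0 ∨ (v i).2 = 1 := by omega
    rcases hk with hk | hk
    · exact ⟨i, j, (v i).1, hij, Prod.ext rfl hk, Prod.ext hi.symm (by simp; omega)⟩
    · exact ⟨j, i, (v i).1, hij.symm, Prod.ext hi.symm (by simp; omega), Prod.ext rfl hk⟩
  obtain ⟨σ, h2, h3⟩ := perm i j hij
  have h4 := α.toAlternatingMap.map_perm (fun i ↦ e (v i)) σ
  have h5 : (fun i ↦ e (v i)) ∘ σ = ![e (v (σ 0)), e (v (σ 1)), e (a, 0), e (a, 1)] := by
    funext k
    fin_cases k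
    · rfl
    · rfl
    · exact congrArg e ((congrArg v h2).trans hi)
    · exact congrArg e ((congrArg v h3).trans hj)
  rw [h5] at h4
  have h6 := f (v (σ 0)) (v (σ 1)) a
  exact (smul_eq_zero_iff_eq (Equiv.Perm.sign σ)).1 (h4.symm.trans h6)

/-! ### Torsion connections of SU(3)-structures -/

section SU3

variable {E : Type*} [NormedAddCommGroup E] [NormedSpace ℝ E] [FiniteDimensional ℝ E]
  {M : Type*} [TopologicalSpace M] [T2Space M] [ChartedSpace E M] [IsManifold 𝓘(ℝ, E) ∞ M]
  [RiemannianBundle (fun x : M ↦ TangentSpace 𝓘(ℝ, E) x)]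
  [IsContMDiffRiemannianBundle 𝓘(ℝ, E) ∞ E (fun x : M ↦ TangentSpace 𝓘(ℝ, E) x)]
  {x : M} {D : CovariantDerivative 𝓘(ℝ, E) E (TangentSpace 𝓘(ℝ, E) : M → Type _)}
  {S : SU3Structure E M}

/-- The curvature of a torsion connection takes values in trace-free endomorphisms. -/
theorem SU3Structure.IsTorsionConnection.sum_inner_curvature (hD : S.IsTorsionConnection D)
    (e : OrthonormalBasis (Fin 3 × Fin 2) ℝ (TangentSpace 𝓘(ℝ, E) x))
    (hΨ : ∀ v : Fin 3 → TangentSpace 𝓘(ℝ, E) x, S.Ψ x v = -Matrix.det (Matrix.of fun a b : Fin 3 ↦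
      ((inner ℝ (e (a, 0)) (v b) : ℝ) : ℂ) + Complex.I * ((inner ℝ (e (a, 1)) (v b) : ℝ) : ℂ)))
    (u v : TangentSpace 𝓘(ℝ, E) x) :
    ∑ a, (inner ℝ (curvature D x u v (e (a, 0))) (e (a, 1)) : ℝ) = 0 := by
  -- On (e₁, e₃, e₅), replacing one entry, say e₁, by w turns Ψ into -(⟨e₁,w⟩ + i⟨e₂,w⟩). The
  -- imaginary part of the identity is therefore the required sum.
  have h := form_curvature S.smooth_Ψ hD.smooth hD.parallel_Ψ u v (e (0, 0)) (e (1, 0)) (e (2, 0))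
  have ho : ∀ i j, (inner ℝ (e i) (e j) : ℝ) = if i = j then 1 else 0 := fun i j ↦
    e.inner_eq_ite i j
  rw [hΨ, hΨ, hΨ] at h
  simp only [Matrix.det_fin_three, Matrix.of_apply, Matrix.cons_val_zero, Matrix.cons_val_one,
    Matrix.cons_val, ho, Prod.mk.injEq] at h
  have h' := congrArg Complex.im h
  simp at h'
  rw [Fin.sum_univ_three, real_inner_comm, real_inner_comm (e (1, 1)), real_inner_comm (e (2, 1))]
  linarith

theorem SU3Structure.IsTorsionConnection.ricci_J (hD : S.IsTorsionConnection D)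
    (hb : S.IsBalanced) (e : OrthonormalBasis (Fin 3 × Fin 2) ℝ (TangentSpace 𝓘(ℝ, E) x))
    (hJ : ∀ a, S.J x (e (a, 0)) = e (a, 1))
    (hΨ : ∀ v : Fin 3 → TangentSpace 𝓘(ℝ, E) x, S.Ψ x v = -Matrix.det (Matrix.of fun a b : Fin 3 ↦
      ((inner ℝ (e (a, 0)) (v b) : ℝ) : ℂ) + Complex.I * ((inner ℝ (e (a, 1)) (v b) : ℝ) : ℂ)))
    (v w : TangentSpace 𝓘(ℝ, E) x) :
    2 * ricci D x v (S.J x w) =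
      -∑ a, extDerivForm (torsionForm D hD.skew) x ![v, w, e (a, 0), e (a, 1)] := by
  have hJ' : ∀ a, S.J x (e (a, 1)) = -e (a, 0) := fun a ↦ by rw [← hJ, S.J_sq]
  have h1 := hD.sum_inner_curvature e hΨ v w
  have h2 := S.sum_covDerivForm_torsionForm_J hb hD.parallel_J hD.smooth hD.metric hD.skew e v w
  have h3 := fun a ↦ curvature_eq_extDerivForm hD.smooth hD.metric hD.skew v w (e (a, 0)) (e (a, 1))
  have h4 : ∀ u z, (inner ℝ (curvature D x u v (S.J x w)) z : ℝ) =
      -inner ℝ (curvature D x u v w) (S.J x z) := fun u z ↦ by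
    rw [S.curvature_J hD.parallel_J hD.metric hD.smooth, S.inner_J_left]
  rw [Fintype.sum_prod_type] at h2
  rw [ricci_eq_sum hD.smooth e, Fintype.sum_prod_type]
  -- The sum `h2` runs over six vectors, but (e, Je) and (Je, -e) contribute equally, so the sum
  -- over three pairs vanishes as well.
  simp only [Fin.sum_univ_two, hJ, hJ', h4, inner_neg_right, neg_neg,
    covDerivForm_neg_right (isSmoothForm_torsionForm hD.smooth hD.skew),
    covDerivForm_swap_right v w (e (_, 0)) (e (_, 1))] at h2 ⊢
  have h5 := Finset.sum_congr rfl fun a (_ : a ∈ Finset.univ) ↦ h3 a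
  simp only [Fin.sum_univ_three] at *
  linarith

theorem SU3Structure.IsTorsionConnection.ricci_eq_zero_iff (hD : S.IsTorsionConnection D)
    (hb : S.IsBalanced) :
    (∀ (x : M) (v w : TangentSpace 𝓘(ℝ, E) x), ricci D x v w = 0) ↔
      (∀ x : M, extDerivForm (torsionForm D hD.skew) x = 0) ∧
        ∀ (x : M) (v : Fin 2 → TangentSpace 𝓘(ℝ, E) x),
          codifferential (torsionForm D hD.skew) x v = 0 := by
  refine ⟨fun h ↦ ⟨fun x ↦ ?_, fun x v ↦ ?_⟩, fun ⟨h, _⟩ x v w ↦ ?_⟩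
  · obtain ⟨e, hJ, hΨ⟩ := S.exists_adapted_basis x
    refine alternating_eq_zero_of_contraction e.toBasis _ fun v w ↦ ?_
    have := hD.ricci_J hb e hJ hΨ v w
    rw [h, mul_zero] at this
    simpa using this.symm
  · have hv : v = ![v 0, v 1] := funext fun i ↦ by fin_cases i <;> rfl
    rw [hv, codifferential_eq_ricci hD.smooth hD.metric hD.skew, h, h, sub_zero]
  · obtain ⟨e, hJ, hΨ⟩ := S.exists_adapted_basis x
    -- As J is invertible, inserting -Jw leaves w itself in the Ricci tensor.
    have := hD.ricci_J hb e hJ hΨ v (-S.J x w)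
    rw [map_neg, S.J_sq, neg_neg, h] at this
    simpa using this

end SU3

end TorsionGeometry

end

theorem mainTheorem10
    {M : Type*} [TopologicalSpace M] [T2Space M] [ChartedSpace (EuclideanSpace ℝ (Fin 6)) M]
    [IsManifold (𝓡 6) ∞ M]
    [RiemannianBundle (fun x : M ↦ TangentSpace (𝓡 6) x)]
    [IsContMDiffRiemannianBundle (𝓡 6) ∞ (EuclideanSpace ℝ (Fin 6))
      (fun x : M ↦ TangentSpace (𝓡 6) x)]
    (S : TorsionGeometry.SU3Structure (EuclideanSpace ℝ (Fin 6)) M)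
    (D : CovariantDerivative (𝓡 6) (EuclideanSpace ℝ (Fin 6))
      (TangentSpace (𝓡 6) : M → Type _))
    (hD : S.IsTorsionConnection D)
    (hbal : S.IsBalanced) :
    (∀ (x : M) (v w : TangentSpace (𝓡 6) x), TorsionGeometry.ricci D x v w = 0) ↔
      ((∀ x : M, TorsionGeometry.extDerivForm (TorsionGeometry.torsionForm D hD.skew) x = 0) ∧
        ∀ (x : M) (v : Fin 2 → TangentSpace (𝓡 6) x),
          TorsionGeometry.codifferential (TorsionGeometry.torsionForm D hD.skew) x v = 0) := by
  exact hD.ricci_eq_zero_iff hbal
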